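/- Let $n\ge 1$, let $H=-\Delta+|x|^2$ be the harmonic oscillator on $\mathbb{R}^n$, and for $\tau>0$ let $$\mathcal{W}_\tau(x,y)=\frac{1}{(2\pi\sinh 2\tau)^{n/2}}\exp\Big(-\tfrac12|x-y|^2\coth 2\tau-x\cdot y\,\tanh\tau\Big),\qquad x,y\in\mathbb{R}^n,$$ be the Mehler kernel, i.e. the integral kernel of the heat semigroup $e^{-\tau H}$. For $f\in L^2(\mathbb{R}^{n+1})=L^2(\mathbb{R}\times\mathbb{R}^n,dt\,dx;\mathbb{C})$ put $$(\partial_t+H)^{-1}f(t,x)=\int_0^\infty e^{-\tau H}\big[f(t-\tau,\cdot)\big](x)\,d\tau=\int_0^\infty\int_{\mathbb{R}^n}\mathcal{W}_\tau(x,y)\,f(t-\tau,y)\,dy\,d\tau .$$ For every $f\in L^2(\mathbb{R}^{n+1})$ this double integral converges absolutely for a.e. $(t,x)$ and defines a function in $L^2(\mathbb{R}^{n+1})$. Moreover, the parabolic Hermite–Riesz transforms $$R^H_{ij}=\partial_{x_ix_j}(\partial_t+H)^{-1}\quad(1\le i,j\le n),\qquad R^H_t=\partial_t(\partial_t+H)^{-1}$$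 are bounded operators on $L^2(\mathbb{R}^{n+1})$. That is, for all $i,j$ there is a unique bounded linear operator $R^H_{ij}$ on $L^2(\mathbb{R}^{n+1})$ such that, for every $f\in L^2(\mathbb{R}^{n+1})$, $R^H_{ij}f$ is the distributional derivative $\partial_{x_ix_j}$ of $(\partial_t+H)^{-1}f$; and there is a unique bounded linear operator $R^H_t$ on $L^2(\mathbb{R}^{n+1})$ such that, for every $f\in L^2(\mathbb{R}^{n+1})$, $R^H_tf$ is the distributional derivative $\partial_t$ of $(\partial_t+H)^{-1}f$. -/

import Mathlib

open MeasureTheory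
open scoped ContDiff

noncomputable section

/-- The space `ℝⁿ` with its Euclidean norm and Lebesgue measure. -/
abbrev Rn (n : ℕ) : Type := EuclideanSpace ℝ (Fin n)

/-- Space-time `ℝⁿ⁺¹ = {(t, x) : t ∈ ℝ, x ∈ ℝⁿ}`; its `volume` is Lebesgue measure `dt dx`. -/
abbrev SpaceTime (n : ℕ) : Type := ℝ × Rn n

/-- The complex Hilbert space `L²(ℝⁿ⁺¹)`. -/
abbrev L2SpaceTime (n : ℕ) : Type := Lp ℂ 2 (volume : Measure (SpaceTime n))

/-- The Mehler kernel `𝒲_τ(x, y)` (used for `τ > 0`): the integral kernel of the heat semigroup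
`e^{-τH}` of the harmonic oscillator `H = -Δ + |x|²` on `ℝⁿ`. -/
def mehlerKernel {n : ℕ} (τ : ℝ) (x y : Rn n) : ℝ :=
  1 / (2 * Real.pi * Real.sinh (2 * τ)) ^ ((n : ℝ) / 2) *
    Real.exp (-(1 / 2) * ‖x - y‖ ^ 2 * (Real.cosh (2 * τ) / Real.sinh (2 * τ))
      - inner ℝ x y * Real.tanh τ)

/-- The heat semigroup `e^{-τH} φ (x) = ∫ 𝒲_τ(x, y) φ(y) dy`, for `τ > 0`. -/
def hermiteSemigroup {n : ℕ} (τ : ℝ) (φ : Rn n → ℂ) (x : Rn n) : ℂ :=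
  ∫ y, mehlerKernel τ x y • φ y

/-- The inverse `(∂ₜ + H)⁻¹ = ∫₀^∞ e^{-τ∂ₜ} ∘ e^{-τH} dτ`, where `e^{-τ∂ₜ}` is the translation
`t ↦ t - τ` in time. -/
def parabolicHermiteInv {n : ℕ} (f : SpaceTime n → ℂ) (p : SpaceTime n) : ℂ :=
  ∫ τ in Set.Ioi (0 : ℝ), hermiteSemigroup τ (fun y => f (p.1 - τ, y)) p.2

/-- The double integral `∫₀^∞ ∫ 𝒲_τ(x, y) f(t - τ, y) dy dτ` defining `(∂ₜ + H)⁻¹ f` at the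
point `p = (t, x)` is absolutely convergent. -/
def ParabolicHermiteInvConverges {n : ℕ} (f : SpaceTime n → ℂ) (p : SpaceTime n) : Prop :=
  Integrable (fun q : ℝ × Rn n => mehlerKernel q.1 p.2 q.2 • f (p.1 - q.1, q.2))
    (((volume : Measure ℝ).restrict (Set.Ioi 0)).prod (volume : Measure (Rn n)))

/-- The unit vector of `ℝⁿ⁺¹` in the direction of time. -/
def timeDir (n : ℕ) : SpaceTime n := (1, 0)

/-- The unit vector of `ℝⁿ⁺¹` in the direction of the space variable `xᵢ`. -/
def spaceDir {n : ℕ} (i : Fin n) : SpaceTime n := (0, EuclideanSpace.single i 1)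

/-- `g` is the weak (distributional) derivative of `u` in the direction `v`. -/
def IsWeakDeriv {n : ℕ} (v : SpaceTime n) (u g : SpaceTime n → ℂ) : Prop :=
  LocallyIntegrable u ∧ LocallyIntegrable g ∧
    ∀ φ : SpaceTime n → ℂ, ContDiff ℝ ∞ φ → HasCompactSupport φ →
      ∫ p, u p * fderiv ℝ φ p v = -∫ p, g p * φ p

/-- `g` is the weak (distributional) second derivative `∂_v ∂_w u` of `u`. -/
def IsWeakDeriv₂ {n : ℕ} (v w : SpaceTime n) (u g : SpaceTime n → ℂ) : Prop :=
  LocallyIntegrable u ∧ LocallyIntegrable g ∧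
    ∀ φ : SpaceTime n → ℂ, ContDiff ℝ ∞ φ → HasCompactSupport φ →
      ∫ p, u p * fderiv ℝ (fun q => fderiv ℝ φ q w) p v = ∫ p, g p * φ p

/-- `R` is the parabolic Hermite–Riesz transform `∂_{xᵢ xⱼ} (∂ₜ + H)⁻¹` on `L²(ℝⁿ⁺¹)`. -/
def IsHermiteRieszSpace {n : ℕ} (i j : Fin n) (R : L2SpaceTime n → L2SpaceTime n) : Prop :=
  ∀ f : L2SpaceTime n, IsWeakDeriv₂ (spaceDir i) (spaceDir j) (parabolicHermiteInv f) (R f)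

/-- `R` is the parabolic Hermite–Riesz transform `∂ₜ (∂ₜ + H)⁻¹` on `L²(ℝⁿ⁺¹)`. -/
def IsHermiteRieszTime {n : ℕ} (R : L2SpaceTime n → L2SpaceTime n) : Prop :=
  ∀ f : L2SpaceTime n, IsWeakDeriv (timeDir n) (parabolicHermiteInv f) (R f)

end

/-!
The proof rests on explicit Gaussian wave packets. For `ξ ∈ ℝⁿ` the function

`v_ξ(t, x) = exp (-nt + π² e^{-4t} |ξ|² - |x|² / 2 - 2πi e^{-2t} x · ξ)`

solves `(∂ₜ + H) v_ξ = 0`, and a Gaussian integral shows that `e^{-τH}` maps `v_ξ(t - τ, ·)` to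
`v_ξ(t, ·)`. Hence, for a test function `a` of time, `ψ = a v_ξ` is a Schwartz function with
`(∂ₜ + H) ψ = a' v_ξ` and `(∂ₜ + H)⁻¹ (a' v_ξ) = a v_ξ`.

* Boundedness of `(∂ₜ + H)⁻¹` and absolute convergence follow from Schur's test with the ground
  state `exp (-|x|² / 2)` as weight, which the semigroup multiplies by `e^{-nτ}`
  (`lintegral_positiveInv_sq_le`).
* For every Schwartz function `ψ`, integration by parts gives
  `‖(∂ₜ + H) ψ‖² = ‖∂ₜ ψ‖² + ‖H ψ‖²` and `∑ ‖∂ᵢ∂ⱼ ψ‖² = ‖Δψ‖² ≤ ‖H ψ‖² + 2n ‖ψ‖²`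
  (`norm_parabolicHermite_sq`, `norm_spaceDeriv_sq_le`).
* The functions `(∂ₜ + H) ψ`, with `ψ` a Schwartz function such that
  `(∂ₜ + H)⁻¹ (∂ₜ + H) ψ = ψ`, are dense in `L²` (`denseRange_parabolicHermite`): if `g` is
  orthogonal to all `a' v_ξ`, then it is orthogonal to all `b v_ξ`, because `b - b(· - s)` is the
  derivative of a test function and `b(· - s) v_ξ → 0` in `L²` as `s → ∞`. So for almost every `t`
  the Fourier transform of `exp (-|x|² / 2) g(t, x)` in `x` vanishes, and `g = 0`.

For these `ψ` the term `2n ‖ψ‖²` is controlled by the boundedness of `(∂ₜ + H)⁻¹`. The operators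
`(∂ₜ + H) ψ ↦ ∂ₜ ψ` and `(∂ₜ + H) ψ ↦ ∂ᵢ∂ⱼ ψ` therefore extend to `L²`, and the identity defining the weak derivative passes to the limit (`exists_weak_comp_inv`). Uniqueness is
the uniqueness of weak derivatives.
-/

/-! ### The Mehler kernel acting on Gaussians -/

section MehlerGaussian

variable {n : ℕ}

theorem coth_two_mul_sub_tanh {τ : ℝ} (hτ : 0 < τ) :
    Real.cosh (2 * τ) / Real.sinh (2 * τ) - Real.tanh τ = 1 / Real.sinh (2 * τ) := by
  have hs : Real.sinh τ ≠ 0 := (Real.sinh_pos_iff.2 hτ).ne'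
  have hc : Real.cosh τ ≠ 0 := (Real.cosh_pos τ).ne'
  rw [Real.tanh_eq_sinh_div_cosh, Real.sinh_two_mul, Real.cosh_two_mul]
  field_simp
  nlinarith [Real.cosh_sq τ]

/-- The Mehler kernel with its exponent expanded: the coefficient of `x · y` is
`coth 2τ - tanh τ = 1 / sinh 2τ`. -/
theorem mehlerKernel_eq {τ : ℝ} (hτ : 0 < τ) (x y : Rn n) :
    mehlerKernel τ x y = 1 / (2 * Real.pi * Real.sinh (2 * τ)) ^ ((n : ℝ) / 2) *
      Real.exp (-(1 / 2) * (‖x‖ ^ 2 + ‖y‖ ^ 2) * (Real.cosh (2 * τ) / Real.sinh (2 * τ))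
        + inner ℝ x y / Real.sinh (2 * τ)) := by
  have h := coth_two_mul_sub_tanh hτ
  have h2 : inner ℝ x y / Real.sinh (2 * τ) = inner ℝ x y *
      (Real.cosh (2 * τ) / Real.sinh (2 * τ) - Real.tanh τ) := by rw [h]; ring
  rw [mehlerKernel, h2, norm_sub_sq_real]
  congr 2
  ring

theorem mehlerKernel_nonneg {τ : ℝ} (hτ : 0 < τ) (x y : Rn n) : 0 ≤ mehlerKernel τ x y := by
  have : 0 < Real.sinh (2 * τ) := Real.sinh_pos_iff.2 (by linarith)
  unfold mehlerKernel
  positivity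

theorem mehlerKernel_symm (τ : ℝ) (x y : Rn n) : mehlerKernel τ x y = mehlerKernel τ y x := by
  rw [mehlerKernel, mehlerKernel, norm_sub_rev, real_inner_comm]

/-- The integrand of `e^{-τH}` applied to `y ↦ exp (-|y|² / 2 + ζ · y)`, with the terms in `y`
collected: `(1 + coth 2τ) / 2 = e^{2τ} / (2 sinh 2τ)`. -/
theorem mehlerKernel_smul_gaussian_eq {τ : ℝ} (hτ : 0 < τ) (x y : Rn n) (ζ : Fin n → ℂ) :
    mehlerKernel τ x y • Complex.exp (-(‖y‖ : ℂ) ^ 2 / 2 + ∑ i, ζ i * y i) =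
      (((1 / (2 * Real.pi * Real.sinh (2 * τ)) ^ ((n : ℝ) / 2) : ℝ) : ℂ) *
        Complex.exp (-(1 / 2) * (‖x‖ : ℂ) ^ 2 *
          ((Real.cosh (2 * τ) / Real.sinh (2 * τ) : ℝ) : ℂ))) *
      Complex.exp (-((Real.exp (2 * τ) / (2 * Real.sinh (2 * τ)) : ℝ) : ℂ) * ∑ i, (y i : ℂ) ^ 2
        + ∑ i, ((x i / Real.sinh (2 * τ) : ℝ) + ζ i) * y i) := by
  have hS : (Real.sinh (2 * τ) : ℂ) ≠ 0 := by
    exact_mod_cast (Real.sinh_pos_iff.2 (by linarith : 0 < 2 * τ)).ne'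
  have hy : ((∑ i, (y i : ℂ) ^ 2 : ℂ)) = (‖y‖ : ℂ) ^ 2 := by
    exact_mod_cast (EuclideanSpace.real_norm_sq_eq y).symm
  have hxy : (∑ i, ((x i / Real.sinh (2 * τ) : ℝ) + ζ i) * (y i : ℂ)) =
      ((inner ℝ x y / Real.sinh (2 * τ) : ℝ) : ℂ) + ∑ i, ζ i * y i := by
    simp only [add_mul, Finset.sum_add_distrib, PiLp.inner_apply, RCLike.inner_apply, conj_trivial]
    push_cast
    rw [Finset.sum_div]
    congr 1
    refine Finset.sum_congr rfl fun i _ => by ring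
  have hE : Real.exp (2 * τ) = Real.cosh (2 * τ) + Real.sinh (2 * τ) := (Real.cosh_add_sinh _).symm
  rw [mehlerKernel_eq hτ, Complex.real_smul, hy, hxy, hE, Complex.ofReal_mul, Complex.ofReal_exp,
    mul_assoc, mul_assoc (Complex.ofReal _), ← Complex.exp_add, ← Complex.exp_add]
  congr 2
  generalize Real.sinh (2 * τ) = S at *
  generalize Real.cosh (2 * τ) = C at *
  push_cast
  field_simp
  ring

theorem integrable_mehlerKernel_smul_gaussian {τ : ℝ} (hτ : 0 < τ) (x : Rn n) (ζ : Fin n → ℂ) :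
    Integrable fun y : Rn n =>
      mehlerKernel τ x y • Complex.exp (-(‖y‖ : ℂ) ^ 2 / 2 + ∑ i, ζ i * y i) := by
  have hS : 0 < Real.sinh (2 * τ) := Real.sinh_pos_iff.2 (by linarith)
  simp only [mehlerKernel_smul_gaussian_eq hτ]
  refine Integrable.const_mul ?_ _
  rw [← (PiLp.volume_preserving_toLp (Fin n)).integrable_comp_emb
    (MeasurableEquiv.toLp 2 _).measurableEmbedding]
  exact GaussianFourier.integrable_cexp_neg_mul_sum_add
    (b := ((Real.exp (2 * τ) / (2 * Real.sinh (2 * τ)) : ℝ) : ℂ))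
    (by rw [Complex.ofReal_re]; positivity) _

/-- The heat semigroup of the harmonic oscillator maps Gaussians to Gaussians. -/
theorem integral_mehlerKernel_smul_gaussian {τ : ℝ} (hτ : 0 < τ) (x : Rn n) (ζ : Fin n → ℂ) :
    ∫ y : Rn n, mehlerKernel τ x y • Complex.exp (-(‖y‖ : ℂ) ^ 2 / 2 + ∑ i, ζ i * y i) =
      Complex.exp (-(n * τ : ℝ) - (‖x‖ : ℂ) ^ 2 / 2 + Real.exp (-2 * τ) * ∑ i, ζ i * x i +
        (1 - Real.exp (-4 * τ)) / 4 * ∑ i, ζ i ^ 2) := by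
  have hS : 0 < Real.sinh (2 * τ) := Real.sinh_pos_iff.2 (by linarith)
  have hS' : (Real.sinh (2 * τ) : ℂ) ≠ 0 := by exact_mod_cast hS.ne'
  simp only [mehlerKernel_smul_gaussian_eq hτ]
  rw [integral_const_mul, ← (PiLp.volume_preserving_toLp (Fin n)).integral_comp
    (MeasurableEquiv.toLp 2 _).measurableEmbedding]
  have hb : 0 < ((Real.exp (2 * τ) / (2 * Real.sinh (2 * τ)) : ℝ) : ℂ).re := by
    rw [Complex.ofReal_re]; positivity
  refine (congrArg _ (GaussianFourier.integral_cexp_neg_mul_sum_add hb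
    (fun i => ((x i / Real.sinh (2 * τ) : ℝ) + ζ i)))).trans ?_
  have hpre : (1 / (2 * Real.pi * Real.sinh (2 * τ)) ^ ((n : ℝ) / 2) : ℝ) *
      (Real.pi / (Real.exp (2 * τ) / (2 * Real.sinh (2 * τ)))) ^ ((n : ℝ) / 2) =
      Real.exp (-(n * τ)) := by
    have : Real.pi / (Real.exp (2 * τ) / (2 * Real.sinh (2 * τ))) =
        (2 * Real.pi * Real.sinh (2 * τ)) * Real.exp (-(2 * τ)) := by
      rw [Real.exp_neg]; field_simp
    rw [this, Real.mul_rpow (x := 2 * Real.pi * Real.sinh (2 * τ)) (by positivity) (by positivity),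
      ← mul_assoc, one_div,
      inv_mul_cancel₀ (by positivity), one_mul, ← Real.exp_mul]
    congr 1
    ring
  have hcp : ((Real.pi : ℂ) / ((Real.exp (2 * τ) / (2 * Real.sinh (2 * τ)) : ℝ) : ℂ)) ^
      ((Fintype.card (Fin n) : ℂ) / 2) =
      (((Real.pi / (Real.exp (2 * τ) / (2 * Real.sinh (2 * τ)))) ^ ((n : ℝ) / 2) : ℝ) : ℂ) := by
    rw [Complex.ofReal_cpow (by positivity)]
    push_cast
    simp
  have hx : ((∑ i, (x i : ℂ) ^ 2 : ℂ)) = (‖x‖ : ℂ) ^ 2 := by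
    exact_mod_cast (EuclideanSpace.real_norm_sq_eq x).symm
  have hsum : (∑ i, (((x i / Real.sinh (2 * τ) : ℝ) : ℂ) + ζ i) ^ 2) =
      (‖x‖ : ℂ) ^ 2 / Real.sinh (2 * τ) ^ 2 + 2 / Real.sinh (2 * τ) * ∑ i, ζ i * x i +
        ∑ i, ζ i ^ 2 := by
    rw [← hx, Finset.mul_sum, Finset.sum_div, ← Finset.sum_add_distrib, ← Finset.sum_add_distrib]
    refine Finset.sum_congr rfl fun i _ => ?_
    rw [Complex.ofReal_div]
    field_simp
    ring
  rw [hcp, hsum, mul_right_comm, ← mul_assoc, ← Complex.ofReal_mul, hpre, Complex.ofReal_exp,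
    ← Complex.exp_add, ← Complex.exp_add]
  congr 1
  -- everything is now a rational function of `e ^ (2 * τ)`
  have h2 : Real.exp (-2 * τ) = (Real.exp (2 * τ))⁻¹ := by rw [← Real.exp_neg]; congr 1; ring
  have h4 : Real.exp (-4 * τ) = (Real.exp (2 * τ))⁻¹ ^ 2 := by
    rw [← Real.exp_neg, ← Real.exp_nat_mul]; congr 1; push_cast; ring
  rw [Real.sinh_eq] at hS' ⊢
  rw [Real.cosh_eq, h2, h4, Real.exp_neg]
  rw [Real.exp_neg] at hS'
  have he : (Real.exp (2 * τ) : ℂ) ≠ 0 := by exact_mod_cast (Real.exp_pos _).ne'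
  generalize Real.exp (2 * τ) = e at *
  push_cast at *
  have h1 : (e : ℂ) ^ 2 - 1 ≠ 0 := by
    intro h
    apply hS'
    field_simp
    rw [h, mul_zero]
  have h1' : (e : ℂ) - (e : ℂ)⁻¹ = ((e : ℂ) ^ 2 - 1) / e := by field_simp
  rw [h1']
  field_simp
  ring

end MehlerGaussian

/-! ### Weighted Schur test and boundedness of the inverse -/

section SchurTest

open scoped ENNReal

variable {n : ℕ}

theorem measurable_mehlerKernel {α : Type*} [MeasurableSpace α] {τ : α → ℝ} {x y : α → Rn n}
    (hτ : Measurable τ) (hx : Measurable x) (hy : Measurable y) :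
    Measurable fun a => mehlerKernel (τ a) (x a) (y a) := by
  unfold mehlerKernel
  simp only [Real.tanh_eq_sinh_div_cosh]
  fun_prop

/-- The unnormalised ground state `exp (-|x|² / 2)` of the harmonic oscillator, the weight of the
Schur test. -/
noncomputable def groundState (x : Rn n) : ℝ≥0∞ := ENNReal.ofReal (Real.exp (-(‖x‖ ^ 2 / 2)))

theorem groundState_ne_zero (x : Rn n) : groundState x ≠ 0 := by
  simp [groundState, Real.exp_pos]

theorem groundState_ne_top (x : Rn n) : groundState x ≠ ⊤ := ENNReal.ofReal_ne_top

theorem measurable_groundState : Measurable (groundState : Rn n → ℝ≥0∞) := by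
  unfold groundState
  fun_prop

/-- The ground state is an eigenfunction of the heat semigroup: `e^{-τH} w = e^{-nτ} w`. -/
theorem lintegral_mehlerKernel_mul_groundState {τ : ℝ} (hτ : 0 < τ) (x : Rn n) :
    ∫⁻ y, ENNReal.ofReal (mehlerKernel τ x y) * groundState y =
      ENNReal.ofReal (Real.exp (-(n * τ))) * groundState x := by
  have hint := integrable_mehlerKernel_smul_gaussian hτ x (fun _ => 0)
  have heq := integral_mehlerKernel_smul_gaussian hτ x (fun _ => 0)
  have hpt : ∀ y : Rn n, mehlerKernel τ x y •
      Complex.exp (-(‖y‖ : ℂ) ^ 2 / 2 + ∑ i : Fin n, (fun _ => (0 : ℂ)) i * y i) =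
      ((mehlerKernel τ x y * Real.exp (-(‖y‖ ^ 2 / 2)) : ℝ) : ℂ) := by
    intro y
    rw [Complex.real_smul]
    push_cast
    simp only [zero_mul, Finset.sum_const_zero, add_zero]
    congr 2
    ring
  simp only [hpt] at hint heq
  have hint' : Integrable fun y : Rn n => mehlerKernel τ x y * Real.exp (-(‖y‖ ^ 2 / 2)) := by
    refine hint.re.congr (Filter.Eventually.of_forall fun y => ?_)
    exact Complex.ofReal_re _
  have heq' : ∫ y : Rn n, mehlerKernel τ x y * Real.exp (-(‖y‖ ^ 2 / 2)) =
      Real.exp (-(n * τ)) * Real.exp (-(‖x‖ ^ 2 / 2)) := by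
    apply Complex.ofReal_injective
    rw [← integral_complex_ofReal, heq, ← Real.exp_add]
    push_cast
    congr 1
    simp
    ring
  simp only [groundState]
  rw [← ENNReal.ofReal_mul (Real.exp_nonneg _), ← heq', ofReal_integral_eq_lintegral_ofReal hint'
    (Filter.Eventually.of_forall fun y => mul_nonneg (mehlerKernel_nonneg hτ x y)
      (Real.exp_nonneg _))]
  refine lintegral_congr fun y => ?_
  rw [ENNReal.ofReal_mul (mehlerKernel_nonneg hτ x y)]

theorem lintegral_Ioi_exp_neg_mul (hn : 1 ≤ n) :
    ∫⁻ τ in Set.Ioi (0 : ℝ), ENNReal.ofReal (Real.exp (-(n * τ))) = ENNReal.ofReal (1 / n) := by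
  have hn' : (0 : ℝ) < n := by exact_mod_cast hn
  have hi : IntegrableOn (fun τ : ℝ => Real.exp (-(n * τ))) (Set.Ioi 0) := by
    simpa only [neg_mul] using exp_neg_integrableOn_Ioi 0 hn'
  rw [← ofReal_integral_eq_lintegral_ofReal hi
    (Filter.Eventually.of_forall fun y => Real.exp_nonneg _)]
  congr 1
  have := integral_exp_mul_Ioi (a := -(n : ℝ)) (by linarith) 0
  simp only [neg_mul] at this
  rw [this]
  simp

/-- The measure `dτ dy` on `(0, ∞) × ℝⁿ`. -/
noncomputable def halfLine (n : ℕ) : Measure (ℝ × Rn n) :=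
  ((volume : Measure ℝ).restrict (Set.Ioi 0)).prod (volume : Measure (Rn n))

instance : SFinite (halfLine n) := by unfold halfLine; infer_instance

/-- The integral operator `(∂ₜ + H)⁻¹` on functions with values in `[0, ∞]`. -/
noncomputable def positiveInv (F : SpaceTime n → ℝ≥0∞) (p : SpaceTime n) : ℝ≥0∞ :=
  ∫⁻ q, ENNReal.ofReal (mehlerKernel q.1 p.2 q.2) * F (p.1 - q.1, q.2) ∂halfLine n

theorem positiveInv_eq {F : SpaceTime n → ℝ≥0∞} (hF : Measurable F) (p : SpaceTime n) :
    positiveInv F p = ∫⁻ τ in Set.Ioi (0 : ℝ), ∫⁻ y,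
      ENNReal.ofReal (mehlerKernel τ p.2 y) * F (p.1 - τ, y) := by
  unfold positiveInv halfLine
  rw [lintegral_prod]
  have := measurable_mehlerKernel (n := n) (α := ℝ × Rn n) measurable_fst
    (measurable_const (a := p.2)) measurable_snd
  fun_prop

theorem measurable_positiveInv {F : SpaceTime n → ℝ≥0∞} (hF : Measurable F) :
    Measurable (positiveInv F) := by
  unfold positiveInv
  have := measurable_mehlerKernel (n := n) (α := SpaceTime n × (ℝ × Rn n)) (τ := fun a => a.2.1)
    (x := fun a => a.1.2) (y := fun a => a.2.2) (by fun_prop) (by fun_prop) (by fun_prop)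
  apply Measurable.lintegral_prod_right'
    (f := fun a : SpaceTime n × (ℝ × Rn n) =>
      ENNReal.ofReal (mehlerKernel a.2.1 a.1.2 a.2.2) * F (a.1.1 - a.2.1, a.2.2))
  fun_prop

theorem positiveInv_groundState (hn : 1 ≤ n) (p : SpaceTime n) :
    positiveInv (fun q => groundState q.2) p = ENNReal.ofReal (1 / n) * groundState p.2 := by
  have hw : Measurable fun q : SpaceTime n => groundState q.2 :=
    measurable_groundState.comp measurable_snd
  rw [positiveInv_eq hw]
  rw [setLIntegral_congr_fun measurableSet_Ioi
    (fun τ hτ => lintegral_mehlerKernel_mul_groundState hτ p.2)]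
  rw [lintegral_mul_const _ (by fun_prop), lintegral_Ioi_exp_neg_mul hn]

/-- Cauchy–Schwarz with the weight `groundState`. -/
theorem positiveInv_sq_le (hn : 1 ≤ n) {F : SpaceTime n → ℝ≥0∞} (hF : Measurable F)
    (p : SpaceTime n) :
    positiveInv F p ^ 2 ≤ ENNReal.ofReal (1 / n) *
      (groundState p.2 * positiveInv (fun q => (groundState q.2)⁻¹ * F q ^ 2) p) := by
  have hK := measurable_mehlerKernel (n := n) (α := ℝ × Rn n) measurable_fst
    (measurable_const (a := p.2)) measurable_snd
  have hw := measurable_groundState (n := n)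
  have h := ENNReal.lintegral_mul_norm_pow_le (μ := halfLine n)
    (f := fun q => ENNReal.ofReal (mehlerKernel q.1 p.2 q.2) * groundState q.2)
    (g := fun q => ENNReal.ofReal (mehlerKernel q.1 p.2 q.2) *
      ((groundState q.2)⁻¹ * F (p.1 - q.1, q.2) ^ 2))
    (by fun_prop) (by fun_prop) (p := 1 / 2) (q := 1 / 2) (by norm_num) (by norm_num) (by norm_num)
  have hpt : ∀ q : ℝ × Rn n,
      (ENNReal.ofReal (mehlerKernel q.1 p.2 q.2) * groundState q.2) ^ (1 / 2 : ℝ) *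
      (ENNReal.ofReal (mehlerKernel q.1 p.2 q.2) *
      ((groundState q.2)⁻¹ * F (p.1 - q.1, q.2) ^ 2)) ^ (1 / 2 : ℝ) =
      ENNReal.ofReal (mehlerKernel q.1 p.2 q.2) * F (p.1 - q.1, q.2) := by
    intro q
    rw [← ENNReal.mul_rpow_of_nonneg _ _ (by norm_num)]
    have : ∀ a w f : ℝ≥0∞, w ≠ 0 → w ≠ ⊤ → a * w * (a * (w⁻¹ * f ^ 2)) = (a * f) ^ (2 : ℝ) := by
      intro a w f h0 h1
      calc a * w * (a * (w⁻¹ * f ^ 2)) = (w * w⁻¹) * (a * f) ^ 2 := by ring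
        _ = _ := by rw [ENNReal.mul_inv_cancel h0 h1, one_mul, ENNReal.rpow_two]
    rw [this _ _ _ (groundState_ne_zero _) (groundState_ne_top _), ← ENNReal.rpow_mul]
    norm_num
  simp only [hpt] at h
  change positiveInv F p ≤ (positiveInv (fun q => groundState q.2) p) ^ (1 / 2 : ℝ) *
    (positiveInv (fun q => (groundState q.2)⁻¹ * F q ^ 2) p) ^ (1 / 2 : ℝ) at h
  rw [← ENNReal.mul_rpow_of_nonneg _ _ (by norm_num), positiveInv_groundState hn, mul_assoc] at h
  calc positiveInv F p ^ 2 ≤ _ := pow_le_pow_left' h 2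
    _ = _ := by rw [← ENNReal.rpow_two, ← ENNReal.rpow_mul]; norm_num

/-- `(∂ₜ + H)⁻¹` is self-adjoint up to time reversal, so the ground state is also the weight of
the transposed operator. -/
theorem lintegral_groundState_mul_positiveInv (hn : 1 ≤ n) {F : SpaceTime n → ℝ≥0∞}
    (hF : Measurable F) :
    ∫⁻ p : SpaceTime n, groundState p.2 * positiveInv F p =
      ENNReal.ofReal (1 / n) * ∫⁻ p : SpaceTime n, groundState p.2 * F p := by
  have hw := measurable_groundState (n := n)
  have hK := measurable_mehlerKernel (n := n) (α := SpaceTime n × (ℝ × Rn n)) (τ := fun a => a.2.1)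
    (x := fun a => a.1.2) (y := fun a => a.2.2) (by fun_prop) (by fun_prop) (by fun_prop)
  have hK' := measurable_mehlerKernel (n := n) (α := (ℝ × Rn n) × SpaceTime n) (τ := fun a => a.1.1)
    (x := fun a => a.2.2) (y := fun a => a.1.2) (by fun_prop) (by fun_prop) (by fun_prop)
  have hinner : ∀ q : ℝ × Rn n, 0 < q.1 →
      ∫⁻ p : SpaceTime n, groundState p.2 *
        (ENNReal.ofReal (mehlerKernel q.1 p.2 q.2) * F (p.1 - q.1, q.2)) =
      ENNReal.ofReal (Real.exp (-(n * q.1))) * (groundState q.2 * ∫⁻ t, F (t, q.2)) := by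
    intro q hq
    have : ∀ p : SpaceTime n, groundState p.2 *
        (ENNReal.ofReal (mehlerKernel q.1 p.2 q.2) * F (p.1 - q.1, q.2)) =
        F (p.1 - q.1, q.2) * (ENNReal.ofReal (mehlerKernel q.1 q.2 p.2) * groundState p.2) := by
      intro p
      rw [mehlerKernel_symm]
      ring
    simp only [this, Measure.volume_eq_prod]
    have hKq' := measurable_mehlerKernel (n := n) (α := Rn n) (measurable_const (a := q.1))
      (measurable_const (a := q.2)) measurable_id
    rw [lintegral_prod_mul (f := fun t => F (t - q.1, q.2))
      (g := fun x => ENNReal.ofReal (mehlerKernel q.1 q.2 x) * groundState x)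
      (by fun_prop) (by fun_prop), lintegral_mehlerKernel_mul_groundState hq,
      lintegral_sub_right_eq_self (fun t => F (t, q.2)) q.1]
    ring
  calc ∫⁻ p : SpaceTime n, groundState p.2 * positiveInv F p
      = ∫⁻ p : SpaceTime n, ∫⁻ q, groundState p.2 *
        (ENNReal.ofReal (mehlerKernel q.1 p.2 q.2) * F (p.1 - q.1, q.2)) ∂halfLine n := by
        refine lintegral_congr fun p => ?_
        rw [positiveInv, lintegral_const_mul]
        have := measurable_mehlerKernel (n := n) (α := ℝ × Rn n) measurable_fst
          (measurable_const (a := p.2)) measurable_snd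
        fun_prop
    _ = ∫⁻ q, (∫⁻ p : SpaceTime n, groundState p.2 *
        (ENNReal.ofReal (mehlerKernel q.1 p.2 q.2) * F (p.1 - q.1, q.2))) ∂halfLine n := by
        apply lintegral_lintegral_swap
        unfold Function.uncurry
        fun_prop
    _ = ∫⁻ τ in Set.Ioi (0 : ℝ), ∫⁻ y, ENNReal.ofReal (Real.exp (-(n * τ))) *
          (groundState y * ∫⁻ t, F (t, y)) := by
        unfold halfLine
        rw [lintegral_prod]
        · refine setLIntegral_congr_fun measurableSet_Ioi fun τ hτ => ?_
          exact lintegral_congr fun y => hinner (τ, y) hτ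
        · apply Measurable.aemeasurable
          apply Measurable.lintegral_prod_right'
            (f := fun a : (ℝ × Rn n) × SpaceTime n => groundState a.2.2 *
              (ENNReal.ofReal (mehlerKernel a.1.1 a.2.2 a.1.2) * F (a.2.1 - a.1.1, a.1.2)))
          fun_prop
    _ = ENNReal.ofReal (1 / n) * ∫⁻ y, groundState y * ∫⁻ t, F (t, y) := by
        have hm : Measurable fun y => ∫⁻ t, F (t, y) := hF.lintegral_prod_left'
        have hwm : Measurable fun y => groundState y * ∫⁻ t, F (t, y) := hw.mul hm
        rw [lintegral_congr fun τ : ℝ => lintegral_const_mul (ENNReal.ofReal (Real.exp (-(n * τ))))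
          hwm, lintegral_mul_const _ (by fun_prop), lintegral_Ioi_exp_neg_mul hn]
    _ = _ := by
        rw [Measure.volume_eq_prod, lintegral_prod_symm _ (by fun_prop)]
        congr 1
        refine lintegral_congr fun y => ?_
        exact (lintegral_const_mul _ (by fun_prop)).symm

theorem lintegral_positiveInv_sq_le (hn : 1 ≤ n) {F : SpaceTime n → ℝ≥0∞} (hF : Measurable F) :
    ∫⁻ p, positiveInv F p ^ 2 ≤ ENNReal.ofReal (1 / n) ^ 2 * ∫⁻ p, F p ^ 2 := by
  have hw := measurable_groundState (n := n)
  have hG : Measurable fun q : SpaceTime n => (groundState q.2)⁻¹ * F q ^ 2 := by fun_prop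
  calc ∫⁻ p, positiveInv F p ^ 2
      ≤ ∫⁻ p, ENNReal.ofReal (1 / n) *
        (groundState p.2 * positiveInv (fun q => (groundState q.2)⁻¹ * F q ^ 2) p) :=
        lintegral_mono fun p => positiveInv_sq_le hn hF p
    _ = ENNReal.ofReal (1 / n) * (ENNReal.ofReal (1 / n) *
        ∫⁻ p : SpaceTime n, groundState p.2 * ((groundState p.2)⁻¹ * F p ^ 2)) := by
        rw [lintegral_const_mul, lintegral_groundState_mul_positiveInv hn hG]
        have := measurable_positiveInv hG
        fun_prop
    _ = _ := by
        rw [sq, mul_assoc]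
        congr 3
        funext p
        rw [← mul_assoc, ENNReal.mul_inv_cancel (groundState_ne_zero _) (groundState_ne_top _),
          one_mul]

end SchurTest

section InverseOnL2

open scoped ENNReal

variable {n : ℕ}

theorem convergesAt_of_positiveInv_lt_top {f : SpaceTime n → ℂ} (hf : StronglyMeasurable f)
    {p : SpaceTime n} (h : positiveInv (fun q => ‖f q‖ₑ) p < ⊤) :
    ParabolicHermiteInvConverges f p := by
  have hK := measurable_mehlerKernel (n := n) (α := ℝ × Rn n) measurable_fst
    (measurable_const (a := p.2)) measurable_snd
  refine ⟨?_, ?_⟩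
  · refine (hK.stronglyMeasurable.smul (hf.comp_measurable ?_)).aestronglyMeasurable
    fun_prop
  · have hpos : ∀ᵐ q ∂halfLine n, 0 < q.1 := by
      unfold halfLine
      exact Measure.quasiMeasurePreserving_fst.ae (ae_restrict_mem measurableSet_Ioi)
    refine lt_of_eq_of_lt (lintegral_congr_ae ?_) h
    filter_upwards [hpos] with q hq
    rw [enorm_smul, Real.enorm_of_nonneg (mehlerKernel_nonneg hq _ _)]

theorem ae_positiveInv_lt_top (hn : 1 ≤ n) {f : SpaceTime n → ℂ} (hf : StronglyMeasurable f)
    (hf2 : MemLp f 2) : ∀ᵐ p, positiveInv (fun q => ‖f q‖ₑ) p < ⊤ := by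
  have hm : Measurable fun q => ‖f q‖ₑ := hf.enorm
  have h2 : ∫⁻ p, positiveInv (fun q => ‖f q‖ₑ) p ^ 2 < ⊤ := by
    refine (lintegral_positiveInv_sq_le hn hm).trans_lt (ENNReal.mul_lt_top (by simp) ?_)
    have := lintegral_rpow_enorm_lt_top_of_eLpNorm_lt_top (by norm_num) (by norm_num) hf2.2
    simpa using this
  filter_upwards [ae_lt_top (by have := measurable_positiveInv hm; fun_prop) h2.ne] with p hp
  contrapose! hp
  simp [top_le_iff.1 hp]

theorem parabolicHermiteInv_eq_integral {f : SpaceTime n → ℂ} {p : SpaceTime n}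
    (h : ParabolicHermiteInvConverges f p) :
    parabolicHermiteInv f p =
      ∫ q, mehlerKernel q.1 p.2 q.2 • f (p.1 - q.1, q.2) ∂halfLine n :=
  (integral_prod _ h).symm

theorem stronglyMeasurable_parabolicHermiteInv {f : SpaceTime n → ℂ} (hf : StronglyMeasurable f) :
    StronglyMeasurable (parabolicHermiteInv f) := by
  have hK := measurable_mehlerKernel (n := n) (α := (SpaceTime n × ℝ) × Rn n) (τ := fun a => a.1.2)
    (x := fun a => a.1.1.2) (y := fun a => a.2) (by fun_prop) (by fun_prop) (by fun_prop)
  have h1 : StronglyMeasurable fun a : (SpaceTime n × ℝ) × Rn n =>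
      mehlerKernel a.1.2 a.1.1.2 a.2 • f (a.1.1.1 - a.1.2, a.2) :=
    hK.stronglyMeasurable.smul (hf.comp_measurable (by fun_prop))
  exact (h1.integral_prod_right' (ν := volume)).integral_prod_right'

/-- Linearity and positivity in one estimate. Taking for `h` a function that equals `c f + g` only
almost everywhere shows that `(∂ₜ + H)⁻¹` is well defined on classes in `L²`. -/
theorem enorm_parabolicHermiteInv_sub_le {f g h : SpaceTime n → ℂ} {p : SpaceTime n} (c : ℂ)
    (hf : ParabolicHermiteInvConverges f p) (hg : ParabolicHermiteInvConverges g p)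
    (hh : ParabolicHermiteInvConverges h p) :
    ‖parabolicHermiteInv h p - (c * parabolicHermiteInv f p + parabolicHermiteInv g p)‖ₑ ≤
      positiveInv (fun q => ‖h q - (c * f q + g q)‖ₑ) p := by
  have hpos : ∀ᵐ q ∂halfLine n, 0 < q.1 := by
    unfold halfLine
    exact Measure.quasiMeasurePreserving_fst.ae (ae_restrict_mem measurableSet_Ioi)
  rw [parabolicHermiteInv_eq_integral hf, parabolicHermiteInv_eq_integral hg,
    parabolicHermiteInv_eq_integral hh]
  change Integrable _ (halfLine n) at hf hg hh
  have hfg : Integrable (fun q => c * (mehlerKernel q.1 p.2 q.2 • f (p.1 - q.1, q.2)) +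
      mehlerKernel q.1 p.2 q.2 • g (p.1 - q.1, q.2)) (halfLine n) := (hf.const_mul c).add hg
  rw [← integral_const_mul, ← integral_add (hf.const_mul c) hg, ← integral_sub hh hfg]
  refine (enorm_integral_le_lintegral_enorm _).trans_eq (lintegral_congr_ae ?_)
  filter_upwards [hpos] with q hq
  rw [← Real.enorm_of_nonneg (mehlerKernel_nonneg hq _ _), ← enorm_smul]
  congr 1
  simp only [Complex.real_smul]
  ring

theorem parabolicHermiteInv_zero : parabolicHermiteInv (fun _ : SpaceTime n => (0 : ℂ)) = 0 := by
  funext p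
  simp [parabolicHermiteInv, hermiteSemigroup]

theorem eLpNorm_two_le_of_lintegral_sq_le {α : Type*} [MeasurableSpace α] {μ : Measure α}
    {f g : α → ℂ} {C : ℝ≥0∞} (h : ∫⁻ a, ‖f a‖ₑ ^ 2 ∂μ ≤ C ^ 2 * ∫⁻ a, ‖g a‖ₑ ^ 2 ∂μ) :
    eLpNorm f 2 μ ≤ C * eLpNorm g 2 μ := by
  have key : ∀ k : α → ℂ, eLpNorm k 2 μ ^ 2 = ∫⁻ a, ‖k a‖ₑ ^ 2 ∂μ := by
    intro k
    have := eLpNorm_nnreal_pow_eq_lintegral (f := k) (μ := μ) (p := 2) (by norm_num)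
    simpa using this
  rw [← key, ← key, ← mul_pow] at h
  exact (ENNReal.pow_le_pow_left_iff two_ne_zero).1 h

theorem eLpNorm_parabolicHermiteInv_sub_le (hn : 1 ≤ n) {f g h : SpaceTime n → ℂ} (c : ℂ)
    (hf : StronglyMeasurable f) (hg : StronglyMeasurable g) (hh : StronglyMeasurable h)
    (hf2 : MemLp f 2) (hg2 : MemLp g 2) (hh2 : MemLp h 2) :
    eLpNorm (fun p => parabolicHermiteInv h p -
      (c * parabolicHermiteInv f p + parabolicHermiteInv g p)) 2 volume ≤
      ENNReal.ofReal (1 / n) * eLpNorm (fun q => h q - (c * f q + g q)) 2 volume := by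
  refine eLpNorm_two_le_of_lintegral_sq_le (le_trans (lintegral_mono_ae ?_)
    (lintegral_positiveInv_sq_le hn
      (F := fun q => ‖h q - (c * f q + g q)‖ₑ) (hh.sub ((hf.const_mul c).add hg)).enorm))
  filter_upwards [ae_positiveInv_lt_top hn hf hf2, ae_positiveInv_lt_top hn hg hg2,
    ae_positiveInv_lt_top hn hh hh2] with p h1 h2 h3
  exact pow_le_pow_left' (enorm_parabolicHermiteInv_sub_le c
    (convergesAt_of_positiveInv_lt_top hf h1) (convergesAt_of_positiveInv_lt_top hg h2)
    (convergesAt_of_positiveInv_lt_top hh h3)) 2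

theorem eLpNorm_parabolicHermiteInv_le (hn : 1 ≤ n) {f : SpaceTime n → ℂ}
    (hf : StronglyMeasurable f) (hf2 : MemLp f 2) :
    eLpNorm (parabolicHermiteInv f) 2 volume ≤ ENNReal.ofReal (1 / n) * eLpNorm f 2 volume := by
  have h0 : MemLp (fun _ : SpaceTime n => (0 : ℂ)) 2 := MemLp.zero'
  simpa [parabolicHermiteInv_zero] using eLpNorm_parabolicHermiteInv_sub_le hn 0
    stronglyMeasurable_const stronglyMeasurable_const hf h0 h0 hf2

theorem memLp_parabolicHermiteInv (hn : 1 ≤ n) {f : SpaceTime n → ℂ}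
    (hf : StronglyMeasurable f) (hf2 : MemLp f 2) : MemLp (parabolicHermiteInv f) 2 :=
  ⟨(stronglyMeasurable_parabolicHermiteInv hf).aestronglyMeasurable,
    (eLpNorm_parabolicHermiteInv_le hn hf hf2).trans_lt (ENNReal.mul_lt_top (by simp) hf2.2)⟩

theorem parabolicHermiteInv_ae_eq_of_ae_eq (hn : 1 ≤ n) {f g h : SpaceTime n → ℂ} (c : ℂ)
    (hf : StronglyMeasurable f) (hg : StronglyMeasurable g) (hh : StronglyMeasurable h)
    (hf2 : MemLp f 2) (hg2 : MemLp g 2) (hh2 : MemLp h 2)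
    (hfg : h =ᵐ[volume] fun q => c * f q + g q) :
    parabolicHermiteInv h =ᵐ[volume]
      fun p => c * parabolicHermiteInv f p + parabolicHermiteInv g p := by
  have h1 := eLpNorm_parabolicHermiteInv_sub_le hn c hf hg hh hf2 hg2 hh2
  have h2 : eLpNorm (fun q => h q - (c * f q + g q)) 2 volume = 0 := by
    rw [eLpNorm_congr_ae (g := fun _ => (0 : ℂ))]
    · simp
    · filter_upwards [hfg] with q hq
      rw [hq, sub_self]
  rw [h2, mul_zero, nonpos_iff_eq_zero, eLpNorm_eq_zero_iff _ (by norm_num)] at h1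
  · filter_upwards [h1] with p hp
    exact sub_eq_zero.1 hp
  · exact ((stronglyMeasurable_parabolicHermiteInv hh).sub
      (((stronglyMeasurable_parabolicHermiteInv hf).const_mul c).add
        (stronglyMeasurable_parabolicHermiteInv hg))).aestronglyMeasurable

/-- The inverse `(∂ₜ + H)⁻¹` as a bounded operator on `L²(ℝⁿ⁺¹)`. -/
noncomputable def parabolicHermiteInvL2 (hn : 1 ≤ n) : L2SpaceTime n →L[ℂ] L2SpaceTime n :=
  LinearMap.mkContinuous
    { toFun := fun f => (memLp_parabolicHermiteInv hn (Lp.stronglyMeasurable f) (Lp.memLp f)).toLp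
      map_add' := fun f g => by
        rw [← MemLp.toLp_add]
        refine MemLp.toLp_congr _ _ ?_
        have := parabolicHermiteInv_ae_eq_of_ae_eq hn 1 (Lp.stronglyMeasurable f)
          (Lp.stronglyMeasurable g) (Lp.stronglyMeasurable (f + g)) (Lp.memLp f) (Lp.memLp g)
          (Lp.memLp (f + g)) (by simpa using! Lp.coeFn_add f g)
        simpa using! this
      map_smul' := fun c f => by
        rw [RingHom.id_apply, ← MemLp.toLp_const_smul]
        refine MemLp.toLp_congr _ _ ?_
        have := parabolicHermiteInv_ae_eq_of_ae_eq hn c (Lp.stronglyMeasurable f)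
          (g := fun _ => 0) stronglyMeasurable_const (Lp.stronglyMeasurable (c • f)) (Lp.memLp f)
          MemLp.zero' (Lp.memLp (c • f)) (by simpa using! Lp.coeFn_smul c f)
        simpa [parabolicHermiteInv_zero] using! this }
    (1 / n) fun f => by
      have h := eLpNorm_parabolicHermiteInv_le hn (Lp.stronglyMeasurable f) (Lp.memLp f)
      have h2 := ENNReal.toReal_mono (ENNReal.mul_ne_top (by simp) (Lp.memLp f).2.ne) h
      rw [ENNReal.toReal_mul, ENNReal.toReal_ofReal (by positivity)] at h2
      simp only [LinearMap.coe_mk, AddHom.coe_mk]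
      rw [Lp.norm_toLp, Lp.norm_def]
      exact h2

theorem coeFn_parabolicHermiteInvL2 (hn : 1 ≤ n) (f : L2SpaceTime n) :
    parabolicHermiteInvL2 hn f =ᵐ[volume] parabolicHermiteInv f :=
  MemLp.coeFn_toLp (memLp_parabolicHermiteInv hn (Lp.stronglyMeasurable f) (Lp.memLp f))

end InverseOnL2

/-! ### The energy identity for the harmonic oscillator -/

section Energy

variable {V E ι : Type*} [AddCommGroup V] [Module ℂ V] [NormedAddCommGroup E]
  [InnerProductSpace ℂ E]

/-- The cross terms `-2 Re ⟨Dᵢ² u, Xⱼ² u⟩` are non-negative up to the commutator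
`[Dᵢ, Xⱼ] = δᵢⱼ`. -/
theorem re_inner_laplacian_potential_le {e : V →ₗ[ℂ] E} {D X : ι → V →ₗ[ℂ] V}
    [DecidableEq ι]
    (hD : ∀ i u v, inner ℂ (e (D i u)) (e v) = -inner ℂ (e u) (e (D i v)))
    (hX : ∀ i u v, inner ℂ (e (X i u)) (e v) = inner ℂ (e u) (e (X i v)))
    (hDX : ∀ i j u, D i (X j u) = X j (D i u) + if i = j then u else 0) (i j : ι) (u : V) :
    2 * (inner ℂ (e (D i (D i u))) (e (X j (X j u)))).re ≤
      if i = j then 2 * ‖e u‖ ^ 2 else 0 := by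
  have hself : ∀ v : E, (inner ℂ v v).re = ‖v‖ ^ 2 := fun v => inner_self_eq_norm_sq (𝕜 := ℂ) v
  have hsq : inner ℂ (e (D i u)) (e (X j (X j (D i u)))) =
      inner ℂ (e (X j (D i u))) (e (X j (D i u))) := (hX _ _ _).symm
  split_ifs with hij
  · subst hij
    have h1 : inner ℂ (e (D i (D i u))) (e (X i (X i u))) =
        -inner ℂ (e (X i (D i u))) (e (X i (D i u))) - 2 * inner ℂ (e (D i u)) (e (X i u)) := by
      rw [hD, hDX, hDX, if_pos rfl, if_pos rfl, map_add, map_add, map_add, inner_add_right,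
        inner_add_right, hsq]
      ring
    have h2 : inner ℂ (e (D i u)) (e (X i u)) =
        -inner ℂ (e (X i u)) (e (D i u)) - inner ℂ (e u) (e u) := by
      rw [hD, hDX, if_pos rfl, map_add, inner_add_right, hX]
      ring
    have h3 := inner_re_symm (𝕜 := ℂ) (e (D i u)) (e (X i u))
    have h2' := congrArg Complex.re h2
    simp only [RCLike.re_to_complex, Complex.sub_re, Complex.neg_re, hself] at h3 h2'
    rw [h1]
    simp only [Complex.sub_re, Complex.neg_re, hself, Complex.mul_re, Complex.re_ofNat,
      Complex.im_ofNat, zero_mul, sub_zero]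
    nlinarith [sq_nonneg ‖e (X i (D i u))‖]
  · have h1 : inner ℂ (e (D i (D i u))) (e (X j (X j u))) =
        -inner ℂ (e (X j (D i u))) (e (X j (D i u))) := by
      rw [hD, hDX, hDX, if_neg hij, if_neg hij, add_zero, add_zero, hsq]
    rw [h1, Complex.neg_re, hself]
    nlinarith [sq_nonneg ‖e (X j (D i u))‖]

variable [Fintype ι]

/-- The harmonic oscillator `∑ᵢ (-Dᵢ² + Xᵢ²)` built from abstract momentum operators `D` and
position operators `X`. -/
noncomputable def oscillator (D X : ι → V →ₗ[ℂ] V) : V →ₗ[ℂ] V :=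
  ∑ i, (X i ∘ₗ X i - D i ∘ₗ D i)

theorem oscillator_apply (D X : ι → V →ₗ[ℂ] V) (u : V) :
    oscillator D X u = ∑ i, (X i (X i u) - D i (D i u)) := by
  simp [oscillator]

variable {e : V →ₗ[ℂ] E} {D X : ι → V →ₗ[ℂ] V} {T : V →ₗ[ℂ] V}

theorem inner_oscillator_left
    (hD : ∀ i u v, inner ℂ (e (D i u)) (e v) = -inner ℂ (e u) (e (D i v)))
    (hX : ∀ i u v, inner ℂ (e (X i u)) (e v) = inner ℂ (e u) (e (X i v))) (u v : V) :
    inner ℂ (e (oscillator D X u)) (e v) = inner ℂ (e u) (e (oscillator D X v)) := by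
  simp only [oscillator_apply, map_sum, map_sub, sum_inner, inner_sum, inner_sub_left,
    inner_sub_right, hD, hX, neg_neg]

/-- A skew-symmetric operator commuting with the oscillator is orthogonal to it, so
`‖(T + H) u‖² = ‖T u‖² + ‖H u‖²`. -/
theorem norm_add_oscillator_sq
    (hD : ∀ i u v, inner ℂ (e (D i u)) (e v) = -inner ℂ (e u) (e (D i v)))
    (hX : ∀ i u v, inner ℂ (e (X i u)) (e v) = inner ℂ (e u) (e (X i v)))
    (hT : ∀ u v, inner ℂ (e (T u)) (e v) = -inner ℂ (e u) (e (T v)))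
    (hTD : ∀ i u, T (D i u) = D i (T u)) (hTX : ∀ i u, T (X i u) = X i (T u)) (u : V) :
    ‖e (T u + oscillator D X u)‖ ^ 2 = ‖e (T u)‖ ^ 2 + ‖e (oscillator D X u)‖ ^ 2 := by
  have hcomm : T (oscillator D X u) = oscillator D X (T u) := by
    simp only [oscillator_apply, map_sum, map_sub, hTD, hTX]
  have h : inner ℂ (e (T u)) (e (oscillator D X u)) =
      -inner ℂ (e (oscillator D X u)) (e (T u)) := by
    rw [hT, hcomm, inner_oscillator_left hD hX]
  have hre : (inner ℂ (e (T u)) (e (oscillator D X u))).re = 0 := by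
    have h1 := congrArg Complex.re h
    have h2 := inner_re_symm (𝕜 := ℂ) (e (T u)) (e (oscillator D X u))
    simp only [Complex.neg_re, RCLike.re_to_complex] at h1 h2
    linarith
  rw [map_add, norm_add_sq (𝕜 := ℂ), RCLike.re_to_complex, hre]
  ring

/-- Integrating by parts twice, `∑ᵢⱼ ‖Dᵢ Dⱼ u‖² = ‖∑ᵢ Dᵢ² u‖²`. -/
theorem norm_mixed_le_norm_laplacian
    (hD : ∀ i u v, inner ℂ (e (D i u)) (e v) = -inner ℂ (e u) (e (D i v)))
    (hDD : ∀ i j u, D i (D j u) = D j (D i u)) (i j : ι) (u : V) :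
    ‖e (D i (D j u))‖ ^ 2 ≤ ‖e (∑ k, D k (D k u))‖ ^ 2 := by
  have hpt : ∀ k l, inner ℂ (e (D k (D k u))) (e (D l (D l u))) =
      inner ℂ (e (D k (D l u))) (e (D k (D l u))) := by
    intro k l
    calc inner ℂ (e (D k (D k u))) (e (D l (D l u)))
        = -inner ℂ (e (D k u)) (e (D k (D l (D l u)))) := hD _ _ _
      _ = -inner ℂ (e (D k u)) (e (D l (D l (D k u)))) := by rw [hDD k l (D l u), hDD k l u]
      _ = inner ℂ (e (D l (D k u))) (e (D l (D k u))) := (hD _ _ _).symm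
      _ = _ := by rw [hDD l k]
  have hsum : ‖e (∑ k, D k (D k u))‖ ^ 2 = ∑ k, ∑ l, ‖e (D k (D l u))‖ ^ 2 := by
    apply Complex.ofReal_injective
    have := inner_self_eq_norm_sq_to_K (𝕜 := ℂ) (e (∑ k, D k (D k u)))
    push_cast
    refine this.symm.trans ?_
    simp only [map_sum, sum_inner, inner_sum, hpt]
    rw [Finset.sum_comm]
    refine Finset.sum_congr rfl fun k _ => Finset.sum_congr rfl fun l _ => ?_
    exact inner_self_eq_norm_sq_to_K _
  rw [hsum]
  calc ‖e (D i (D j u))‖ ^ 2 ≤ ∑ l, ‖e (D i (D l u))‖ ^ 2 :=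
        Finset.single_le_sum (f := fun l => ‖e (D i (D l u))‖ ^ 2) (fun _ _ => by positivity)
          (Finset.mem_univ j)
    _ ≤ _ := Finset.single_le_sum (f := fun k => ∑ l, ‖e (D k (D l u))‖ ^ 2)
          (fun _ _ => by positivity) (Finset.mem_univ i)

/-- The expansion of `‖X² u - D² u‖²`; the constant `2 * card ι` comes from the commutators in
`re_inner_laplacian_potential_le`. -/
theorem norm_laplacian_sq_le [DecidableEq ι]
    (hD : ∀ i u v, inner ℂ (e (D i u)) (e v) = -inner ℂ (e u) (e (D i v)))
    (hX : ∀ i u v, inner ℂ (e (X i u)) (e v) = inner ℂ (e u) (e (X i v)))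
    (hDX : ∀ i j u, D i (X j u) = X j (D i u) + if i = j then u else 0) (u : V) :
    ‖e (∑ k, D k (D k u))‖ ^ 2 ≤
      ‖e (oscillator D X u)‖ ^ 2 + 2 * Fintype.card ι * ‖e u‖ ^ 2 := by
  have hosc : e (oscillator D X u) = e (∑ k, X k (X k u)) - e (∑ k, D k (D k u)) := by
    rw [oscillator_apply, Finset.sum_sub_distrib, map_sub]
  have hcross : 2 * (inner ℂ (e (∑ k, X k (X k u))) (e (∑ k, D k (D k u)))).re ≤
      2 * Fintype.card ι * ‖e u‖ ^ 2 := by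
    have hsymm := inner_re_symm (𝕜 := ℂ) (e (∑ k, X k (X k u))) (e (∑ k, D k (D k u)))
    simp only [RCLike.re_to_complex] at hsymm
    rw [hsymm]
    simp only [map_sum, sum_inner, inner_sum, Complex.re_sum, Finset.mul_sum]
    calc _ ≤ ∑ i : ι, ∑ j : ι, (if j = i then 2 * ‖e u‖ ^ 2 else 0) :=
          Finset.sum_le_sum fun i _ => Finset.sum_le_sum fun j _ =>
            re_inner_laplacian_potential_le hD hX hDX j i u
      _ = _ := by simp; ring
  rw [hosc, norm_sub_sq (𝕜 := ℂ), RCLike.re_to_complex]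
  nlinarith [sq_nonneg ‖e (∑ k, X k (X k u))‖]

end Energy

/-! ### Energy estimates for Schwartz functions -/

section SchwartzEnergy

open scoped SchwartzMap

variable {n : ℕ}

instance : (volume : Measure (SpaceTime n)).IsAddHaarMeasure :=
  inferInstanceAs (((volume : Measure ℝ).prod (volume : Measure (Rn n))).IsAddHaarMeasure)

/-- The directional derivative `∂_v` on Schwartz functions. -/
noncomputable def schwartzDeriv (v : SpaceTime n) : 𝓢(SpaceTime n, ℂ) →ₗ[ℂ] 𝓢(SpaceTime n, ℂ) :=
  (LineDeriv.lineDerivOpCLM ℂ 𝓢(SpaceTime n, ℂ) v : 𝓢(SpaceTime n, ℂ) →L[ℂ] 𝓢(SpaceTime n, ℂ))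

theorem schwartzDeriv_apply (v : SpaceTime n) (f : 𝓢(SpaceTime n, ℂ)) (p : SpaceTime n) :
    schwartzDeriv v f p = fderiv ℝ f p v := rfl

theorem hasTemperateGrowth_coord (i : Fin n) :
    Function.HasTemperateGrowth fun p : SpaceTime n => (p.2 i : ℂ) :=
  (Complex.ofRealCLM ∘L (EuclideanSpace.proj i : Rn n →L[ℝ] ℝ) ∘L
    ContinuousLinearMap.snd ℝ ℝ (Rn n)).hasTemperateGrowth

/-- Multiplication by the coordinate `xᵢ` on Schwartz functions. -/
noncomputable def schwartzMulCoord (i : Fin n) : 𝓢(SpaceTime n, ℂ) →ₗ[ℂ] 𝓢(SpaceTime n, ℂ) :=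
  (SchwartzMap.smulLeftCLM ℂ (fun p : SpaceTime n => (p.2 i : ℂ)) :
    𝓢(SpaceTime n, ℂ) →L[ℂ] 𝓢(SpaceTime n, ℂ))

theorem schwartzMulCoord_apply (i : Fin n) (f : 𝓢(SpaceTime n, ℂ)) (p : SpaceTime n) :
    schwartzMulCoord i f p = p.2 i * f p :=
  SchwartzMap.smulLeftCLM_apply_apply (hasTemperateGrowth_coord i) f p

/-- The class in `L²(ℝⁿ⁺¹)` of a Schwartz function. -/
noncomputable def schwartzToL2 : 𝓢(SpaceTime n, ℂ) →ₗ[ℂ] L2SpaceTime n :=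
  (SchwartzMap.toLpCLM ℂ ℂ 2 (volume : Measure (SpaceTime n)) :
    𝓢(SpaceTime n, ℂ) →L[ℂ] L2SpaceTime n)

theorem coeFn_schwartzToL2 (f : 𝓢(SpaceTime n, ℂ)) : schwartzToL2 f =ᵐ[volume] f :=
  f.coeFn_toLp 2 volume

theorem inner_schwartzToL2 (f g : 𝓢(SpaceTime n, ℂ)) :
    inner ℂ (schwartzToL2 f) (schwartzToL2 g) = ∫ p, (starRingEnd ℂ) (f p) * g p := by
  refine (SchwartzMap.inner_toL2_toL2_eq f g).trans (integral_congr_ae ?_)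
  filter_upwards with p
  rw [RCLike.inner_apply, mul_comm]

theorem inner_schwartzDeriv (v : SpaceTime n) (f g : 𝓢(SpaceTime n, ℂ)) :
    inner ℂ (schwartzToL2 (schwartzDeriv v f)) (schwartzToL2 g) =
      -inner ℂ (schwartzToL2 f) (schwartzToL2 (schwartzDeriv v g)) := by
  rw [inner_schwartzToL2, inner_schwartzToL2]
  have := SchwartzMap.integral_bilinear_lineDerivOp_right_eq_neg_left (μ := volume) f g
    ((ContinuousLinearMap.mul ℝ ℂ).comp (Complex.conjCLE : ℂ →L[ℝ] ℂ)) v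
  rw [eq_neg_iff_add_eq_zero, add_comm, ← eq_neg_iff_add_eq_zero]
  exact this

theorem inner_schwartzMulCoord (i : Fin n) (f g : 𝓢(SpaceTime n, ℂ)) :
    inner ℂ (schwartzToL2 (schwartzMulCoord i f)) (schwartzToL2 g) =
      inner ℂ (schwartzToL2 f) (schwartzToL2 (schwartzMulCoord i g)) := by
  rw [inner_schwartzToL2, inner_schwartzToL2]
  refine integral_congr_ae (Filter.Eventually.of_forall fun p => ?_)
  simp only [schwartzMulCoord_apply, map_mul, Complex.conj_ofReal]
  ring

theorem schwartzDeriv_comm (v w : SpaceTime n) (f : 𝓢(SpaceTime n, ℂ)) :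
    schwartzDeriv v (schwartzDeriv w f) = schwartzDeriv w (schwartzDeriv v f) := by
  have key : ∀ (a b : SpaceTime n) (p : SpaceTime n),
      schwartzDeriv a (schwartzDeriv b f) p = fderiv ℝ (fderiv ℝ f) p a b := by
    intro a b p
    have hd : DifferentiableAt ℝ (fderiv ℝ f) p :=
      ((f.smooth 2).fderiv_right (m := 1) (by norm_num)).differentiable (by norm_num) p
    change fderiv ℝ (fun q => fderiv ℝ f q b) p a = _
    rw [fderiv_clm_apply hd (differentiableAt_const b)]
    simp
  ext p
  rw [key, key]
  exact ((f.smooth 2).contDiffAt.isSymmSndFDerivAt (by simp)) v w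

theorem schwartzDeriv_mulCoord (v : SpaceTime n) (j : Fin n) (f : 𝓢(SpaceTime n, ℂ)) :
    schwartzDeriv v (schwartzMulCoord j f) =
      schwartzMulCoord j (schwartzDeriv v f) + (v.2 j : ℂ) • f := by
  ext p
  have hfun : (schwartzMulCoord j f : SpaceTime n → ℂ) =
      fun q => (Complex.ofRealCLM ∘L (EuclideanSpace.proj j : Rn n →L[ℝ] ℝ) ∘L
        ContinuousLinearMap.snd ℝ ℝ (Rn n)) q * f q :=
    funext fun q => schwartzMulCoord_apply j f q
  rw [schwartzDeriv_apply, hfun, fderiv_fun_mul (ContinuousLinearMap.differentiableAt _)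
    f.differentiableAt, ContinuousLinearMap.fderiv]
  simp [schwartzMulCoord_apply, schwartzDeriv_apply]
  ring

/-- The harmonic oscillator `H` on Schwartz functions of space-time. -/
noncomputable abbrev schwartzHermite : 𝓢(SpaceTime n, ℂ) →ₗ[ℂ] 𝓢(SpaceTime n, ℂ) :=
  oscillator (fun i => schwartzDeriv (spaceDir i)) schwartzMulCoord

/-- The parabolic operator `∂ₜ + H` on Schwartz functions. -/
noncomputable def parabolicHermite : 𝓢(SpaceTime n, ℂ) →ₗ[ℂ] 𝓢(SpaceTime n, ℂ) :=
  schwartzDeriv (timeDir n) + schwartzHermite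

theorem norm_parabolicHermite_sq (ψ : 𝓢(SpaceTime n, ℂ)) :
    ‖schwartzToL2 (parabolicHermite ψ)‖ ^ 2 =
      ‖schwartzToL2 (schwartzDeriv (timeDir n) ψ)‖ ^ 2 +
        ‖schwartzToL2 (schwartzHermite ψ)‖ ^ 2 :=
  norm_add_oscillator_sq (fun i => inner_schwartzDeriv (spaceDir i)) inner_schwartzMulCoord
    (inner_schwartzDeriv (timeDir n)) (fun i => schwartzDeriv_comm (timeDir n) (spaceDir i))
    (fun i u => by rw [schwartzDeriv_mulCoord]; simp [timeDir]) ψ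

theorem norm_timeDeriv_le (ψ : 𝓢(SpaceTime n, ℂ)) :
    ‖schwartzToL2 (schwartzDeriv (timeDir n) ψ)‖ ≤ ‖schwartzToL2 (parabolicHermite ψ)‖ := by
  have := norm_parabolicHermite_sq ψ
  refine (pow_le_pow_iff_left₀ (norm_nonneg _) (norm_nonneg _) two_ne_zero).1 ?_
  nlinarith [sq_nonneg ‖schwartzToL2 (schwartzHermite ψ)‖]

theorem norm_spaceDeriv_sq_le (i j : Fin n) (ψ : 𝓢(SpaceTime n, ℂ)) :
    ‖schwartzToL2 (schwartzDeriv (spaceDir i) (schwartzDeriv (spaceDir j) ψ))‖ ^ 2 ≤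
      ‖schwartzToL2 (parabolicHermite ψ)‖ ^ 2 + 2 * n * ‖schwartzToL2 ψ‖ ^ 2 := by
  have h1 := norm_mixed_le_norm_laplacian (e := schwartzToL2 (n := n))
    (D := fun i => schwartzDeriv (spaceDir i)) (fun i => inner_schwartzDeriv (spaceDir i))
    (fun i j => schwartzDeriv_comm (spaceDir i) (spaceDir j)) i j ψ
  have h2 := norm_laplacian_sq_le (e := schwartzToL2 (n := n))
    (D := fun i => schwartzDeriv (spaceDir i)) (X := schwartzMulCoord)
    (fun i => inner_schwartzDeriv (spaceDir i)) inner_schwartzMulCoord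
    (fun i j u => by
      rw [schwartzDeriv_mulCoord]
      by_cases h : i = j
      · simp [spaceDir, h]
      · simp [spaceDir, h, Ne.symm h]) ψ
  have h3 := norm_parabolicHermite_sq ψ
  rw [Fintype.card_fin] at h2
  nlinarith [sq_nonneg ‖schwartzToL2 (schwartzDeriv (timeDir n) ψ)‖]

end SchwartzEnergy

/-! ### Gaussian wave packets -/

section GaussianSchwartz

open scoped SchwartzMap

theorem exists_abs_eval_mul_gaussian_le (P : Polynomial ℝ) :
    ∃ C, ∀ x : ℝ, |P.eval x| * Real.exp (-(x ^ 2 / 2)) ≤ C := by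
  induction P using Polynomial.induction_on' with
  | add p q hp hq =>
    obtain ⟨C, hC⟩ := hp
    obtain ⟨D, hD⟩ := hq
    refine ⟨C + D, fun x => ?_⟩
    calc |(p + q).eval x| * Real.exp (-(x ^ 2 / 2))
        ≤ (|p.eval x| + |q.eval x|) * Real.exp (-(x ^ 2 / 2)) := by
          rw [Polynomial.eval_add]
          gcongr
          exact abs_add_le _ _
      _ ≤ C + D := by rw [add_mul]; exact add_le_add (hC x) (hD x)
  | monomial m a =>
    refine ⟨|a| * (1 + 2 ^ m * m.factorial), fun x => ?_⟩
    have h1 : |x| ^ m ≤ 1 + x ^ (2 * m) := by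
      have : x ^ (2 * m) = (|x| ^ m) ^ 2 := by rw [← pow_mul, mul_comm m, pow_mul, pow_mul, sq_abs]
      rw [this]
      nlinarith [sq_nonneg (|x| ^ m - 1), pow_nonneg (abs_nonneg x) m]
    have h2 : x ^ (2 * m) * Real.exp (-(x ^ 2 / 2)) ≤ 2 ^ m * m.factorial := by
      have := Real.pow_div_factorial_le_exp (x ^ 2 / 2) (by positivity) m
      rw [Real.exp_neg, ← div_eq_mul_inv, div_le_iff₀ (Real.exp_pos _)]
      rw [div_le_iff₀ (by positivity), div_pow, div_le_iff₀ (by positivity), ← pow_mul] at this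
      linarith
    have h3 : Real.exp (-(x ^ 2 / 2)) ≤ 1 := Real.exp_le_one_iff.2 (by nlinarith [sq_nonneg x])
    rw [Polynomial.eval_monomial, abs_mul, abs_pow, mul_assoc]
    gcongr
    calc |x| ^ m * Real.exp (-(x ^ 2 / 2)) ≤ (1 + x ^ (2 * m)) * Real.exp (-(x ^ 2 / 2)) := by gcongr
      _ ≤ _ := by rw [add_mul, one_mul]; exact add_le_add h3 h2

/-- The Gaussian `exp (-x² / 2)` as a Schwartz function on the line. -/
noncomputable def schwartzGaussian : 𝓢(ℝ, ℝ) where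
  toFun x := Real.exp (-(x ^ 2 / 2))
  smooth' := by fun_prop
  decay' k m := by
    obtain ⟨C, hC⟩ := exists_abs_eval_mul_gaussian_le
      (Polynomial.X ^ k * (Polynomial.hermite m).map (Int.castRingHom ℝ))
    refine ⟨C, fun x => ?_⟩
    rw [norm_iteratedFDeriv_eq_norm_iteratedDeriv, iteratedDeriv_eq_iterate,
      Polynomial.deriv_gaussian_eq_hermite_mul_gaussian]
    refine le_of_eq_of_le ?_ (hC x)
    rw [Polynomial.eval_mul, Polynomial.eval_pow, Polynomial.eval_X, abs_mul, abs_pow,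
      Polynomial.eval_map, norm_mul, norm_mul, norm_pow, norm_neg, norm_one, one_pow, one_mul,
      Real.norm_of_nonneg (Real.exp_nonneg _), ← mul_assoc]
    rfl

variable {n : ℕ}

/-- The Gaussian `exp (-(1 + t² + |x|²) / 2)` is a Schwartz function on space-time: it is the
composition of the Gaussian on the line with `(1 + t² + |x|²) ^ (1 / 2)`. -/
theorem exists_schwartz_gaussian : ∃ G : 𝓢(SpaceTime n, ℂ), ∀ p,
    G p = Real.exp (-((1 + p.1 ^ 2 + ‖p.2‖ ^ 2) / 2)) := by
  let e := (WithLp.prodContinuousLinearEquiv 2 ℝ ℝ (Rn n)).symm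
  have he : ∀ p, ‖e p‖ ^ 2 = p.1 ^ 2 + ‖p.2‖ ^ 2 := fun p => by
    rw [WithLp.prod_norm_sq_eq_of_L2, Real.norm_eq_abs, sq_abs]
    rfl
  let q : SpaceTime n → ℝ := fun p => (1 + ‖e p‖ ^ 2) ^ (1 / 2 : ℝ)
  have hq2 : ∀ p, q p ^ 2 = 1 + p.1 ^ 2 + ‖p.2‖ ^ 2 := fun p => by
    rw [← Real.rpow_natCast, ← Real.rpow_mul (by positivity)]
    norm_num
    rw [he]
    ring
  have hqt : q.HasTemperateGrowth :=
    (Function.hasTemperateGrowth_one_add_norm_sq_rpow (WithLp 2 (ℝ × Rn n)) (1 / 2)).comp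
      e.hasTemperateGrowth
  have hup : ∃ (k : ℕ) (C : ℝ), ∀ p, ‖p‖ ≤ C * (1 + ‖q p‖) ^ k := by
    refine ⟨1, 1, fun p => ?_⟩
    have hq0 : 0 ≤ q p := by positivity
    rw [pow_one, one_mul, Real.norm_of_nonneg hq0, Prod.norm_def]
    refine max_le ?_ ?_
    · refine le_trans (abs_le_of_sq_le_sq (b := q p) ?_ hq0) (by linarith)
      nlinarith [hq2 p, sq_nonneg ‖p.2‖]
    · refine le_trans ((le_abs_self _).trans (abs_le_of_sq_le_sq (b := q p) ?_ hq0)) (by linarith)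
      nlinarith [hq2 p, sq_nonneg p.1]
  refine ⟨SchwartzMap.postcompCLM (𝕜 := ℝ) Complex.ofRealCLM
    (SchwartzMap.compCLM ℝ hqt hup schwartzGaussian), fun p => ?_⟩
  rw [SchwartzMap.postcompCLM_apply, SchwartzMap.compCLM_apply, ← hq2]
  rfl

theorem hasTemperateGrowth_cexp_ofReal_mul_I :
    Function.HasTemperateGrowth fun s : ℝ => Complex.exp (s * Complex.I) := by
  have hit : ∀ m, iteratedDeriv m (fun s : ℝ => Complex.exp (s * Complex.I)) =
      fun s : ℝ => Complex.I ^ m * Complex.exp (s * Complex.I) := by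
    intro m
    induction m with
    | zero => simp
    | succ m ih =>
      rw [iteratedDeriv_succ, ih]
      funext s
      have h : HasDerivAt (fun s : ℝ => Complex.exp (s * Complex.I))
          (Complex.exp (s * Complex.I) * (1 * Complex.I)) s :=
        ((Complex.ofRealCLM.hasDerivAt (x := s)).mul_const Complex.I).cexp
      rw [(h.const_mul _).deriv]
      ring
  refine ⟨(Complex.ofRealCLM.contDiff.mul contDiff_const).cexp, fun m => ⟨0, 1, fun s => ?_⟩⟩
  rw [norm_iteratedFDeriv_eq_norm_iteratedDeriv, hit]
  simp [Complex.norm_exp_ofReal_mul_I]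

end GaussianSchwartz

section WavePacket

open scoped SchwartzMap

variable {n : ℕ}

/-- The solution `e^{-nt} exp (π² e^{-4t} |ξ|² - |x|² / 2 - 2πi e^{-2t} x · ξ)` of
`(∂ₜ + H) v = 0`, a Gaussian oscillating with frequency `e^{-2t} ξ` at time `t`. -/
noncomputable def wavePacket (ξ : Rn n) (p : SpaceTime n) : ℂ :=
  Complex.exp (((-(n * p.1) + Real.pi ^ 2 * Real.exp (-4 * p.1) * ‖ξ‖ ^ 2 - ‖p.2‖ ^ 2 / 2 : ℝ) : ℂ)
    + ((-2 * Real.pi * Real.exp (-2 * p.1) * inner ℝ p.2 ξ : ℝ) : ℂ) * Complex.I)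

/-- On the support of `a` the phase `e^{-2t} x · ξ` may be cut off in time, so that all factors
other than the Gaussian have temperate growth. -/
theorem exists_schwartz_wavePacket {a : ℝ → ℝ} (ha : ContDiff ℝ ∞ a) (ha' : HasCompactSupport a)
    (ξ : Rn n) : ∃ ψ : 𝓢(SpaceTime n, ℂ), ∀ p, ψ p = a p.1 * wavePacket ξ p := by
  obtain ⟨G, hG⟩ := exists_schwartz_gaussian (n := n)
  obtain ⟨R, hR0, hR⟩ : ∃ R : ℝ, 0 < R ∧ tsupport a ⊆ Metric.closedBall 0 R := by
    obtain ⟨R, hR⟩ := ha'.isCompact.isBounded.subset_closedBall 0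
    exact ⟨max R 1, by positivity, hR.trans (Metric.closedBall_subset_closedBall (le_max_left _ _))⟩
  let χ : ContDiffBump (0 : ℝ) := ⟨R, R + 1, hR0, by linarith⟩
  let A : ℝ → ℝ := fun t => a t *
    Real.exp (-(n * t) + Real.pi ^ 2 * Real.exp (-4 * t) * ‖ξ‖ ^ 2 + (1 + t ^ 2) / 2)
  let B : ℝ → ℝ := fun t => χ t * (-2 * Real.pi * Real.exp (-2 * t))
  have hA : A.HasTemperateGrowth :=
    HasCompactSupport.hasTemperateGrowth ha'.mul_right (ha.mul (by fun_prop))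
  have hB : B.HasTemperateGrowth :=
    HasCompactSupport.hasTemperateGrowth χ.hasCompactSupport.mul_right
      (χ.contDiff.mul (by fun_prop))
  have hfst : (Prod.fst : SpaceTime n → ℝ).HasTemperateGrowth :=
    (ContinuousLinearMap.fst ℝ ℝ (Rn n)).hasTemperateGrowth
  have hinner : (fun p : SpaceTime n => inner ℝ p.2 ξ).HasTemperateGrowth :=
    (Function.hasTemperateGrowth_inner_left ξ).comp
      (ContinuousLinearMap.snd ℝ ℝ (Rn n)).hasTemperateGrowth
  have hA' : (fun p : SpaceTime n => (A p.1 : ℂ)).HasTemperateGrowth :=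
    Complex.ofRealCLM.hasTemperateGrowth.comp (hA.comp hfst)
  have hE : (fun p : SpaceTime n =>
      Complex.exp ((B p.1 * inner ℝ p.2 ξ : ℝ) * Complex.I)).HasTemperateGrowth :=
    hasTemperateGrowth_cexp_ofReal_mul_I.comp ((hB.comp hfst).mul hinner)
  have hg : (fun p : SpaceTime n => (A p.1 : ℂ) *
      Complex.exp ((B p.1 * inner ℝ p.2 ξ : ℝ) * Complex.I)).HasTemperateGrowth :=
    hA'.mul hE
  refine ⟨SchwartzMap.smulLeftCLM ℂ (fun p : SpaceTime n => (A p.1 : ℂ) *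
    Complex.exp ((B p.1 * inner ℝ p.2 ξ : ℝ) * Complex.I)) G, fun p => ?_⟩
  rw [SchwartzMap.smulLeftCLM_apply_apply hg, hG, smul_eq_mul]
  by_cases hp : p.1 ∈ tsupport a
  · have hχ : χ p.1 = 1 := χ.one_of_mem_closedBall (hR hp)
    simp only [A, B, hχ, wavePacket, one_mul]
    push_cast
    rw [mul_assoc, mul_assoc, ← Complex.exp_add, mul_assoc, ← Complex.exp_add]
    congr 2
    ring
  · have : a p.1 = 0 := image_eq_zero_of_notMem_tsupport hp
    simp [A, this]

end WavePacket

section WavePacketEquation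

open scoped SchwartzMap

variable {n : ℕ}

theorem schwartzDeriv_eq_of_hasDerivAt {v : SpaceTime n} {f : 𝓢(SpaceTime n, ℂ)} {p : SpaceTime n}
    {d : ℂ} (h : HasDerivAt (fun s : ℝ => f (p + s • v)) d 0) : schwartzDeriv v f p = d := by
  rw [schwartzDeriv_apply, ← f.differentiableAt.lineDeriv_eq_fderiv]
  exact HasLineDerivAt.lineDeriv h

theorem hasDerivAt_line (v : SpaceTime n) (f : 𝓢(SpaceTime n, ℂ)) (p : SpaceTime n) :
    HasDerivAt (fun s : ℝ => f (p + s • v)) (schwartzDeriv v f p) 0 :=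
  f.differentiableAt.hasFDerivAt.hasLineDerivAt v

theorem hasDerivAt_wavePacket_time (ξ : Rn n) (p : SpaceTime n) :
    HasDerivAt (fun s : ℝ => wavePacket ξ (p + s • timeDir n))
      (((-n - 4 * Real.pi ^ 2 * Real.exp (-4 * p.1) * ‖ξ‖ ^ 2 : ℝ) +
        (4 * Real.pi * Real.exp (-2 * p.1) * inner ℝ p.2 ξ : ℝ) * Complex.I) * wavePacket ξ p)
      0 := by
  have ht : HasDerivAt (fun s : ℝ => p.1 + s) 1 0 := (hasDerivAt_id (0 : ℝ)).const_add _
  have hexp : ∀ c : ℝ, HasDerivAt (fun s : ℝ => Real.exp (c * (p.1 + s)))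
      (Real.exp (c * (p.1 + 0)) * (c * 1)) 0 := fun c => (ht.const_mul c).exp
  have h1 : HasDerivAt (fun s : ℝ => -(n * (p.1 + s)) +
      Real.pi ^ 2 * Real.exp (-4 * (p.1 + s)) * ‖ξ‖ ^ 2 - ‖p.2‖ ^ 2 / 2)
      (-(n * 1) + Real.pi ^ 2 * (Real.exp (-4 * (p.1 + 0)) * (-4 * 1)) * ‖ξ‖ ^ 2) 0 :=
    ((ht.const_mul (n : ℝ)).neg.add (((hexp (-4)).const_mul _).mul_const _)).sub_const _
  have h2 : HasDerivAt (fun s : ℝ => -2 * Real.pi * Real.exp (-2 * (p.1 + s)) * inner ℝ p.2 ξ)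
      (-2 * Real.pi * (Real.exp (-2 * (p.1 + 0)) * (-2 * 1)) * inner ℝ p.2 ξ) 0 :=
    ((hexp (-2)).const_mul _).mul_const _
  have h3 := (h1.ofReal_comp.add (h2.ofReal_comp.mul_const Complex.I)).cexp
  have hfun : (fun s : ℝ => wavePacket ξ (p + s • timeDir n)) = fun s : ℝ =>
      Complex.exp (((-(n * (p.1 + s)) +
      Real.pi ^ 2 * Real.exp (-4 * (p.1 + s)) * ‖ξ‖ ^ 2 - ‖p.2‖ ^ 2 / 2 : ℝ) : ℂ) +
      ((-2 * Real.pi * Real.exp (-2 * (p.1 + s)) * inner ℝ p.2 ξ : ℝ) : ℂ) * Complex.I) := by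
    funext s
    simp [wavePacket, timeDir]
  rw [hfun]
  refine h3.congr_deriv ?_
  simp only [add_zero, wavePacket, Pi.add_apply]
  rw [mul_comm]
  congr 1
  push_cast
  ring

theorem hasDerivAt_wavePacket_space (ξ : Rn n) (i : Fin n) (p : SpaceTime n) :
    HasDerivAt (fun s : ℝ => wavePacket ξ (p + s • spaceDir i))
      ((-(p.2 i : ℂ) - (2 * Real.pi * Real.exp (-2 * p.1) * ξ i : ℝ) * Complex.I) *
        wavePacket ξ p) 0 := by
  have hs : HasDerivAt (fun s : ℝ => s) 1 0 := hasDerivAt_id (0 : ℝ)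
  have h1 : HasDerivAt (fun s : ℝ => -(n * p.1) + Real.pi ^ 2 * Real.exp (-4 * p.1) * ‖ξ‖ ^ 2 -
      (‖p.2‖ ^ 2 + 2 * (s * p.2 i) + s ^ 2) / 2)
      (-((2 * (1 * p.2 i) + 2 * 0 ^ 1 * 1) / 2)) 0 := by
    have := (((((hs.mul_const (p.2 i)).const_mul 2).const_add (‖p.2‖ ^ 2)).add
      (hs.pow 2)).div_const 2).const_sub
      (-(n * p.1) + Real.pi ^ 2 * Real.exp (-4 * p.1) * ‖ξ‖ ^ 2)
    simpa using! this
  have h2 : HasDerivAt (fun s : ℝ => -2 * Real.pi * Real.exp (-2 * p.1) *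
      (inner ℝ p.2 ξ + s * ξ i)) (-2 * Real.pi * Real.exp (-2 * p.1) * (1 * ξ i)) 0 :=
    ((hs.mul_const (ξ i)).const_add _).const_mul _
  have h3 := (h1.ofReal_comp.add (h2.ofReal_comp.mul_const Complex.I)).cexp
  have hfun : (fun s : ℝ => wavePacket ξ (p + s • spaceDir i)) = fun s : ℝ =>
      Complex.exp (((-(n * p.1) + Real.pi ^ 2 * Real.exp (-4 * p.1) * ‖ξ‖ ^ 2 -
        (‖p.2‖ ^ 2 + 2 * (s * p.2 i) + s ^ 2) / 2 : ℝ) : ℂ) +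
      ((-2 * Real.pi * Real.exp (-2 * p.1) * (inner ℝ p.2 ξ + s * ξ i) : ℝ) : ℂ) *
        Complex.I) := by
    funext s
    have hnorm : ‖p.2 + s • EuclideanSpace.single i (1 : ℝ)‖ ^ 2 =
        ‖p.2‖ ^ 2 + 2 * (s * p.2 i) + s ^ 2 := by
      rw [norm_add_sq_real, inner_smul_right, norm_smul, EuclideanSpace.inner_single_right]
      simp
    have hin : inner ℝ (p.2 + s • EuclideanSpace.single i (1 : ℝ)) ξ =
        inner ℝ p.2 ξ + s * ξ i := by
      rw [inner_add_left, inner_smul_left, EuclideanSpace.inner_single_left]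
      simp
    simp only [wavePacket, spaceDir, Prod.fst_add, Prod.snd_add, Prod.smul_fst, Prod.smul_snd,
      smul_zero, add_zero, hnorm, hin]
  rw [hfun]
  refine h3.congr_deriv ?_
  simp only [zero_mul, mul_zero, add_zero, wavePacket, Pi.add_apply]
  rw [mul_comm]
  congr 1
  · push_cast
    ring
  · simp

variable {a : ℝ → ℝ} {ξ : Rn n} {ψ : 𝓢(SpaceTime n, ℂ)}

theorem schwartzDeriv_time_wavePacket (ha : ContDiff ℝ ∞ a)
    (hψ : ∀ p, ψ p = a p.1 * wavePacket ξ p) (p : SpaceTime n) :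
    schwartzDeriv (timeDir n) ψ p = deriv a p.1 * wavePacket ξ p +
      ((-n - 4 * Real.pi ^ 2 * Real.exp (-4 * p.1) * ‖ξ‖ ^ 2 : ℝ) +
        (4 * Real.pi * Real.exp (-2 * p.1) * inner ℝ p.2 ξ : ℝ) * Complex.I) * ψ p := by
  apply schwartzDeriv_eq_of_hasDerivAt
  have h1 : HasDerivAt (fun s : ℝ => a (p.1 + s)) (deriv a p.1) 0 := by
    have h := (ha.differentiable (by norm_num)).differentiableAt (x := p.1 + 0) |>.hasDerivAt
    simpa using h.comp_const_add p.1 0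
  have h2 := h1.ofReal_comp.mul (hasDerivAt_wavePacket_time ξ p)
  have hfun : (fun s : ℝ => ψ (p + s • timeDir n)) = (fun s : ℝ => (a (p.1 + s) : ℂ)) *
      fun s : ℝ => wavePacket ξ (p + s • timeDir n) := by
    funext s
    simp [hψ, timeDir]
  rw [hfun]
  refine h2.congr_deriv ?_
  rw [hψ]
  simp only [add_zero, zero_smul]
  ring

theorem schwartzDeriv_space_wavePacket (hψ : ∀ p, ψ p = a p.1 * wavePacket ξ p) (i : Fin n)
    (p : SpaceTime n) : schwartzDeriv (spaceDir i) ψ p =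
      (-(p.2 i : ℂ) - (2 * Real.pi * Real.exp (-2 * p.1) * ξ i : ℝ) * Complex.I) * ψ p := by
  apply schwartzDeriv_eq_of_hasDerivAt
  have h2 := (hasDerivAt_wavePacket_space ξ i p).const_mul (a p.1 : ℂ)
  have hfun : (fun s : ℝ => ψ (p + s • spaceDir i)) =
      fun s : ℝ => (a p.1 : ℂ) * wavePacket ξ (p + s • spaceDir i) := by
    funext s
    simp [hψ, spaceDir]
  rw [hfun]
  refine h2.congr_deriv ?_
  rw [hψ]
  ring

theorem schwartzDeriv_space_space_wavePacket (hψ : ∀ p, ψ p = a p.1 * wavePacket ξ p) (i : Fin n)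
    (p : SpaceTime n) : schwartzDeriv (spaceDir i) (schwartzDeriv (spaceDir i) ψ) p =
      ((-(p.2 i : ℂ) - (2 * Real.pi * Real.exp (-2 * p.1) * ξ i : ℝ) * Complex.I) ^ 2 - 1) *
        ψ p := by
  apply schwartzDeriv_eq_of_hasDerivAt
  have hs : HasDerivAt (fun s : ℝ => p.2 i + s) 1 0 := (hasDerivAt_id (0 : ℝ)).const_add _
  have h2 := (hs.ofReal_comp.neg.sub_const
    ((2 * Real.pi * Real.exp (-2 * p.1) * ξ i : ℝ) * Complex.I)).mul (hasDerivAt_line (spaceDir i) ψ p)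
  have hfun : (fun s : ℝ => schwartzDeriv (spaceDir i) ψ (p + s • spaceDir i)) =
      (fun s : ℝ => -((p.2 i + s : ℝ) : ℂ) -
        (2 * Real.pi * Real.exp (-2 * p.1) * ξ i : ℝ) * Complex.I) *
      fun s : ℝ => ψ (p + s • spaceDir i) := by
    funext s
    rw [schwartzDeriv_space_wavePacket hψ]
    simp [spaceDir]
  rw [hfun]
  refine h2.congr_deriv ?_
  rw [schwartzDeriv_space_wavePacket hψ]
  simp
  ring

/-- Since `wavePacket ξ` solves the homogeneous equation, only the time factor is
differentiated. -/
theorem parabolicHermite_wavePacket (ha : ContDiff ℝ ∞ a)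
    (hψ : ∀ p, ψ p = a p.1 * wavePacket ξ p) (p : SpaceTime n) :
    parabolicHermite ψ p = deriv a p.1 * wavePacket ξ p := by
  have hsum : (schwartzHermite ψ) p = (∑ i : Fin n, ((p.2 i : ℂ) ^ 2 -
      ((-(p.2 i : ℂ) - (2 * Real.pi * Real.exp (-2 * p.1) * ξ i : ℝ) * Complex.I) ^ 2 - 1))) *
        ψ p := by
    rw [oscillator_apply, sum_apply, Finset.sum_mul]
    refine Finset.sum_congr rfl fun i _ => ?_
    rw [sub_apply, schwartzDeriv_space_space_wavePacket hψ, schwartzMulCoord_apply,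
      schwartzMulCoord_apply]
    ring
  have hscal : (∑ i : Fin n, ((p.2 i : ℂ) ^ 2 -
      ((-(p.2 i : ℂ) - (2 * Real.pi * Real.exp (-2 * p.1) * ξ i : ℝ) * Complex.I) ^ 2 - 1))) =
      n + (4 * Real.pi ^ 2 * Real.exp (-4 * p.1) * ‖ξ‖ ^ 2 : ℝ) -
        (4 * Real.pi * Real.exp (-2 * p.1) * inner ℝ p.2 ξ : ℝ) * Complex.I := by
    have hξ : (‖ξ‖ : ℝ) ^ 2 = ∑ i, ξ i ^ 2 := EuclideanSpace.real_norm_sq_eq ξ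
    have hin : inner ℝ p.2 ξ = ∑ i, p.2 i * ξ i := by
      simp [PiLp.inner_apply, mul_comm]
    have h4 : Real.exp (-4 * p.1) = Real.exp (-2 * p.1) ^ 2 := by
      rw [← Real.exp_nat_mul]; congr 1; push_cast; ring
    have hterm : ∀ i : Fin n, ((p.2 i : ℂ) ^ 2 -
        ((-(p.2 i : ℂ) - (2 * Real.pi * Real.exp (-2 * p.1) * ξ i : ℝ) * Complex.I) ^ 2 - 1)) =
        1 + 4 * Real.pi ^ 2 * Real.exp (-2 * p.1) ^ 2 * ξ i ^ 2 -
          4 * Real.pi * Real.exp (-2 * p.1) * Complex.I * (p.2 i * ξ i) := by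
      intro i
      push_cast
      linear_combination (-4 * Real.pi ^ 2 * Complex.exp (-2 * p.1) ^ 2 * ξ i ^ 2 : ℂ) *
        Complex.I_sq
    rw [Finset.sum_congr rfl fun i _ => hterm i, Finset.sum_sub_distrib, Finset.sum_add_distrib,
      ← Finset.mul_sum, ← Finset.mul_sum, h4, hξ, hin]
    simp only [Finset.sum_const, Finset.card_univ, Fintype.card_fin, nsmul_eq_mul, mul_one]
    push_cast
    ring
  have : parabolicHermite ψ p = schwartzDeriv (timeDir n) ψ p + schwartzHermite ψ p := rfl
  rw [this, hsum, hscal, schwartzDeriv_time_wavePacket ha hψ]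
  push_cast
  ring

/-- The heat semigroup propagates the wave packet. -/
theorem hermiteSemigroup_wavePacket {τ : ℝ} (hτ : 0 < τ) (ξ : Rn n) (c : ℂ) (p : SpaceTime n) :
    hermiteSemigroup τ (fun y => c * wavePacket ξ (p.1 - τ, y)) p.2 = c * wavePacket ξ p := by
  set s := p.1 - τ with hs
  have h := integral_mehlerKernel_smul_gaussian hτ p.2
    (fun i => -(2 * Real.pi * Real.exp (-2 * s) * ξ i : ℝ) * Complex.I)
  have hpt : ∀ y : Rn n, mehlerKernel τ p.2 y • (c * wavePacket ξ (s, y)) =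
      (c * Complex.exp ((-(n * s) + Real.pi ^ 2 * Real.exp (-4 * s) * ‖ξ‖ ^ 2 : ℝ) : ℂ)) *
      (mehlerKernel τ p.2 y • Complex.exp (-(‖y‖ : ℂ) ^ 2 / 2 +
        ∑ i, (fun i => -(2 * Real.pi * Real.exp (-2 * s) * ξ i : ℝ) * Complex.I) i * y i)) := by
    intro y
    have hin : inner ℝ y ξ = ∑ i, y i * ξ i := by
      simp [PiLp.inner_apply, mul_comm]
    rw [mul_smul_comm, mul_assoc, ← Complex.exp_add, wavePacket]
    congr 3
    simp only [hin]
    push_cast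
    rw [Finset.mul_sum, Finset.sum_mul, sub_eq_add_neg, ← neg_div, add_assoc]
    congr 2
    refine Finset.sum_congr rfl fun i _ => by ring
  rw [hermiteSemigroup]
  simp only [hpt]
  rw [integral_const_mul, h, mul_assoc, ← Complex.exp_add, wavePacket]
  congr 2
  have hin : inner ℝ p.2 ξ = ∑ i, p.2 i * ξ i := by
    simp [PiLp.inner_apply, mul_comm]
  have hξ : (‖ξ‖ : ℝ) ^ 2 = ∑ i, ξ i ^ 2 := EuclideanSpace.real_norm_sq_eq ξ
  have h1 : ∑ i, (-((2 * Real.pi * Real.exp (-2 * s) * ξ i : ℝ) : ℂ) * Complex.I) * (p.2 i : ℂ) =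
      -(2 * Real.pi * Real.exp (-2 * s) * inner ℝ p.2 ξ : ℝ) * Complex.I := by
    rw [hin]
    push_cast
    rw [Finset.mul_sum, ← Finset.sum_neg_distrib, Finset.sum_mul]
    refine Finset.sum_congr rfl fun i _ => by ring
  have h2 : ∑ i, (-((2 * Real.pi * Real.exp (-2 * s) * ξ i : ℝ) : ℂ) * Complex.I) ^ 2 =
      -(4 * Real.pi ^ 2 * Real.exp (-4 * s) * ‖ξ‖ ^ 2 : ℝ) := by
    have h4 : Real.exp (-4 * s) = Real.exp (-2 * s) ^ 2 := by
      rw [← Real.exp_nat_mul]; congr 1; push_cast; ring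
    rw [hξ, h4]
    push_cast
    rw [Finset.mul_sum, ← Finset.sum_neg_distrib]
    refine Finset.sum_congr rfl fun i _ => ?_
    linear_combination (4 * Real.pi ^ 2 * Complex.exp (-2 * s) ^ 2 * ξ i ^ 2 : ℂ) * Complex.I_sq
  have e2 : Real.exp (-2 * p.1) = Real.exp (-2 * τ) * Real.exp (-2 * s) := by
    rw [← Real.exp_add, hs]; congr 1; ring
  have e4 : Real.exp (-4 * p.1) = Real.exp (-4 * τ) * Real.exp (-4 * s) := by
    rw [← Real.exp_add, hs]; congr 1; ring
  have hp : p.1 = s + τ := by rw [hs]; ring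
  rw [h1, h2, e2, e4, hp]
  push_cast
  ring

theorem parabolicHermiteInv_wavePacket (ha : ContDiff ℝ ∞ a) (ha' : HasCompactSupport a)
    (ξ : Rn n) (p : SpaceTime n) :
    parabolicHermiteInv (fun q => deriv a q.1 * wavePacket ξ q) p = a p.1 * wavePacket ξ p := by
  have hderiv : ∀ τ, deriv (fun σ => a (p.1 - σ)) τ = -deriv a (p.1 - τ) := fun τ =>
    deriv_comp_const_sub ..
  have hint : ∫ τ in Set.Ioi (0 : ℝ), deriv a (p.1 - τ) = a p.1 := by
    have h := HasCompactSupport.integral_Ioi_deriv_eq (f := fun σ => a (p.1 - σ))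
      ((ha.comp (contDiff_const.sub contDiff_id)).of_le (by norm_num))
      (ha'.comp_homeomorph (Homeomorph.subLeft p.1)) 0
    simp only [hderiv, integral_neg, sub_zero, neg_inj] at h
    exact h
  rw [parabolicHermiteInv, setIntegral_congr_fun measurableSet_Ioi
    (fun τ hτ => hermiteSemigroup_wavePacket hτ ξ ((deriv a (p.1 - τ) : ℝ) : ℂ) p), integral_mul_const,
    integral_complex_ofReal, hint]

end WavePacketEquation

/-! ### Density of the range of `∂ₜ + H` -/

section FourierInjective

open scoped FourierTransform

variable {V : Type*} [NormedAddCommGroup V] [InnerProductSpace ℝ V] [FiniteDimensional ℝ V]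
  [MeasurableSpace V] [BorelSpace V]

/-- Injectivity of the Fourier transform on `L¹`, by duality with Schwartz functions. -/
theorem ae_eq_zero_of_fourier_eq_zero {h : V → ℂ} (hh : Integrable h) (h0 : ∀ w, 𝓕 h w = 0) :
    ∀ᵐ x, h x = 0 := by
  refine ae_eq_zero_of_integral_contDiff_smul_eq_zero hh.locallyIntegrable fun g hg hg' => ?_
  let G : SchwartzMap V ℂ :=
    (hg'.comp_left (g := Complex.ofReal) Complex.ofReal_zero).toSchwartzMap
      (Complex.ofRealCLM.contDiff.comp hg)
  have hG : ∀ x, G x = (g x : ℂ) := fun _ => rfl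
  have hinv : 𝓕 ((𝓕⁻ G : SchwartzMap V ℂ) : V → ℂ) = G := by
    rw [← SchwartzMap.fourier_coe, FourierTransform.fourier_fourierInv_eq]
  have key := VectorFourier.integral_fourierIntegral_smul_eq_flip (L := innerₗ V)
    (μ := volume) (ν := volume) Real.continuous_fourierChar continuous_inner hh
    (𝓕⁻ G : SchwartzMap V ℂ).integrable
  have hl : VectorFourier.fourierIntegral Real.fourierChar volume (innerₗ V) h = 0 := funext h0
  have hr : VectorFourier.fourierIntegral Real.fourierChar volume (innerₗ V).flip
      ((𝓕⁻ G : SchwartzMap V ℂ) : V → ℂ) = G := by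
    rw [flip_innerₗ]
    exact hinv
  rw [hl, hr] at key
  simp only [Pi.zero_apply, zero_smul, integral_zero] at key
  rw [key]
  refine integral_congr_ae (Filter.Eventually.of_forall fun x => ?_)
  simp [hG, mul_comm]

end FourierInjective

section Density

open scoped SchwartzMap FourierTransform

variable {n : ℕ}

/-- The Schwartz functions `ψ` that are recovered from `(∂ₜ + H) ψ` by the integral operator
`(∂ₜ + H)⁻¹`. -/
noncomputable def invertibleDomain (hn : 1 ≤ n) : Submodule ℂ 𝓢(SpaceTime n, ℂ) :=
  LinearMap.eqLocus ((parabolicHermiteInvL2 hn).toLinearMap ∘ₗ schwartzToL2 ∘ₗ parabolicHermite)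
    schwartzToL2

theorem mem_invertibleDomain {hn : 1 ≤ n} {ψ : 𝓢(SpaceTime n, ℂ)} :
    ψ ∈ invertibleDomain hn ↔
      parabolicHermiteInvL2 hn (schwartzToL2 (parabolicHermite ψ)) = schwartzToL2 ψ := Iff.rfl

theorem mem_invertibleDomain_of_eq_wavePacket (hn : 1 ≤ n) {a : ℝ → ℝ} (ha : ContDiff ℝ ∞ a)
    (ha' : HasCompactSupport a) {ξ : Rn n} {ψ : 𝓢(SpaceTime n, ℂ)}
    (hψ : ∀ p, ψ p = a p.1 * wavePacket ξ p) : ψ ∈ invertibleDomain hn := by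
  rw [mem_invertibleDomain]
  apply Lp.ext
  have h1 := coeFn_parabolicHermiteInvL2 hn (schwartzToL2 (parabolicHermite ψ))
  have h2 := parabolicHermiteInv_ae_eq_of_ae_eq hn 0 (f := fun _ => 0)
    (g := parabolicHermite ψ) (h := schwartzToL2 (parabolicHermite ψ))
    stronglyMeasurable_const (parabolicHermite ψ).continuous.stronglyMeasurable
    (Lp.stronglyMeasurable _) MemLp.zero' ((parabolicHermite ψ).memLp 2 volume) (Lp.memLp _)
    (by simpa using coeFn_schwartzToL2 (parabolicHermite ψ))
  have hfun : (parabolicHermite ψ : SpaceTime n → ℂ) =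
      fun q => deriv a q.1 * wavePacket ξ q := funext (parabolicHermite_wavePacket ha hψ)
  filter_upwards [h1, h2, coeFn_schwartzToL2 ψ] with p hp1 hp2 hp3
  rw [hp1, hp2, hp3, hfun, parabolicHermiteInv_wavePacket ha ha', hψ]
  ring

theorem norm_wavePacket (ξ : Rn n) (p : SpaceTime n) : ‖wavePacket ξ p‖ =
    Real.exp (-(n * p.1) + Real.pi ^ 2 * Real.exp (-4 * p.1) * ‖ξ‖ ^ 2 - ‖p.2‖ ^ 2 / 2) := by
  rw [wavePacket, Complex.exp_add, norm_mul, Complex.norm_exp_ofReal_mul_I, mul_one,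
    Complex.norm_exp_ofReal]

theorem norm_wavePacket_add_time_le (ξ : Rn n) {s : ℝ} (hs : 0 ≤ s) (p : SpaceTime n) :
    ‖wavePacket ξ (p + (s, 0))‖ ≤ Real.exp (-(n * s)) * ‖wavePacket ξ p‖ := by
  rw [norm_wavePacket, norm_wavePacket, ← Real.exp_add]
  have h : Real.exp (-4 * (p.1 + s)) ≤ Real.exp (-4 * p.1) := Real.exp_le_exp.2 (by linarith)
  have h2 := mul_le_mul_of_nonneg_right
    (mul_le_mul_of_nonneg_left h (sq_nonneg Real.pi)) (sq_nonneg ‖ξ‖)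
  simp only [Prod.fst_add, Prod.snd_add, add_zero]
  refine Real.exp_le_exp.2 ?_
  nlinarith

theorem conj_wavePacket (ξ : Rn n) (p : SpaceTime n) :
    (starRingEnd ℂ) (wavePacket (-ξ) p) = wavePacket ξ p := by
  rw [wavePacket, wavePacket, ← Complex.exp_conj, map_add, map_mul, Complex.conj_ofReal,
    Complex.conj_ofReal, Complex.conj_I, norm_neg, inner_neg_right]
  push_cast
  ring_nf

/-- Wave packets translated far into the future are small in `L²`. -/
theorem norm_translate_wavePacket_le {b : ℝ → ℝ} {ξ : Rn n} {ψ φ : 𝓢(SpaceTime n, ℂ)} {s : ℝ}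
    (hs : 0 ≤ s) (hψ : ∀ p, ψ p = b p.1 * wavePacket ξ p)
    (hφ : ∀ p, φ p = b (p.1 - s) * wavePacket ξ p) :
    ‖schwartzToL2 φ‖ ≤ Real.exp (-(n * s)) * ‖schwartzToL2 ψ‖ := by
  have hnorm : ∀ f : 𝓢(SpaceTime n, ℂ), ‖schwartzToL2 f‖ = (eLpNorm f 2 volume).toReal :=
    fun f => SchwartzMap.norm_toLp
  have htrans : eLpNorm φ 2 volume = eLpNorm (fun p => φ (p + (s, 0))) 2 volume :=
    (eLpNorm_comp_measurePreserving φ.continuous.aestronglyMeasurable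
      (measurePreserving_add_right volume ((s, 0) : SpaceTime n))).symm
  have hle : eLpNorm (fun p => φ (p + (s, 0))) 2 volume ≤
      ENNReal.ofReal (Real.exp (-(n * s))) * eLpNorm ψ 2 volume := by
    refine eLpNorm_le_mul_eLpNorm_of_ae_le_mul (Filter.Eventually.of_forall fun p => ?_) 2
    rw [hφ, hψ, norm_mul, norm_mul]
    calc _ ≤ ‖(b p.1 : ℂ)‖ * (Real.exp (-(n * s)) * ‖wavePacket ξ p‖) := by
          simp only [Prod.fst_add, add_sub_cancel_right]
          exact mul_le_mul_of_nonneg_left (norm_wavePacket_add_time_le ξ hs p) (norm_nonneg _)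
      _ = _ := by ring
  have := ENNReal.toReal_mono (ENNReal.mul_ne_top (by simp) (ψ.memLp 2 volume).2.ne) hle
  rw [ENNReal.toReal_mul, ENNReal.toReal_ofReal (Real.exp_nonneg _)] at this
  rwa [hnorm, hnorm, htrans]

/-- A difference of translates of a test function on the line is the derivative of a test
function. -/
theorem exists_deriv_eq_sub_translate {b : ℝ → ℝ} (hb : ContDiff ℝ ∞ b) (hb' : HasCompactSupport b)
    (s : ℝ) : ∃ a : ℝ → ℝ, ContDiff ℝ ∞ a ∧ HasCompactSupport a ∧
      ∀ t, deriv a t = b t - b (t - s) := by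
  let B : ℝ → ℝ := fun t => ∫ r in (0 : ℝ)..t, b r
  have hBd : ∀ t, HasDerivAt B (b t) t := fun t =>
    (hb.continuous.integral_hasStrictDerivAt 0 t).hasDerivAt
  have hB : ContDiff ℝ ∞ B := by
    rw [contDiff_infty_iff_deriv]
    exact ⟨fun t => (hBd t).differentiableAt, by rwa [funext fun t => (hBd t).deriv]⟩
  refine ⟨fun t => B t - B (t - s), hB.sub (hB.comp (contDiff_id.sub contDiff_const)), ?_,
    fun t => ((hBd t).sub ((hBd (t - s)).comp_sub_const t s)).deriv⟩
  obtain ⟨R, hR⟩ := hb'.isCompact.isBounded.subset_closedBall 0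
  refine HasCompactSupport.intro (isCompact_closedBall (0 : ℝ) (R + |s|)) fun t ht => ?_
  have hsub : B t - B (t - s) = ∫ r in (t - s)..t, b r := by
    simp only [B]
    exact intervalIntegral.integral_interval_sub_left
      (hb.continuous.intervalIntegrable _ _) (hb.continuous.intervalIntegrable _ _)
  rw [hsub, intervalIntegral.integral_congr (g := fun _ => 0)]
  · simp
  intro r hr
  refine image_eq_zero_of_notMem_tsupport fun hmem => ht ?_
  have h1 := hR hmem
  rw [Metric.mem_closedBall, Real.dist_eq, sub_zero] at h1 ⊢
  have h3 : |t - r| ≤ |s| := by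
    have h4 := Set.abs_sub_right_of_mem_uIcc hr
    simpa using h4
  have h5 : t = r + (t - r) := by ring
  calc |t| = |r + (t - r)| := by rw [← h5]
    _ ≤ |r| + |t - r| := abs_add_le _ _
    _ ≤ R + |s| := add_le_add h1 h3

/-- A function orthogonal to the range of `∂ₜ + H` is orthogonal to `b(t) v_ξ(t, x)` for every
test function `b`: modulo that range, `b` may be translated to `+∞`, where `v_ξ` decays. -/
theorem inner_wavePacket_eq_zero (hn : 1 ≤ n) {g : L2SpaceTime n}
    (hg : ∀ ψ ∈ invertibleDomain hn, inner ℂ (schwartzToL2 (parabolicHermite ψ)) g = 0)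
    {b : ℝ → ℝ} (hb : ContDiff ℝ ∞ b) (hb' : HasCompactSupport b) {ξ : Rn n}
    {ψ : 𝓢(SpaceTime n, ℂ)} (hψ : ∀ p, ψ p = b p.1 * wavePacket ξ p) :
    inner ℂ (schwartzToL2 ψ) g = 0 := by
  have hn' : (0 : ℝ) < n := by exact_mod_cast hn
  have hbound : ∀ s : ℝ, 0 ≤ s → ‖inner ℂ (schwartzToL2 ψ) g‖ ≤
      Real.exp (-(n * s)) * ‖schwartzToL2 ψ‖ * ‖g‖ := by
    intro s hs
    obtain ⟨a, ha, ha', had⟩ := exists_deriv_eq_sub_translate hb hb' s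
    obtain ⟨α, hα⟩ := exists_schwartz_wavePacket ha ha' ξ
    obtain ⟨φ, hφ⟩ := exists_schwartz_wavePacket (a := fun t => b (t - s))
      (hb.comp (contDiff_id.sub contDiff_const))
      (hb'.comp_homeomorph (Homeomorph.subRight s)) ξ
    have hdiff : parabolicHermite α = ψ - φ := by
      ext p
      rw [parabolicHermite_wavePacket ha hα, had, sub_apply, hψ, hφ]
      push_cast
      ring
    have h0 := hg α (mem_invertibleDomain_of_eq_wavePacket hn ha ha' hα)
    rw [hdiff, map_sub, inner_sub_left, sub_eq_zero] at h0
    rw [h0]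
    exact (norm_inner_le_norm _ _).trans (mul_le_mul_of_nonneg_right
      (norm_translate_wavePacket_le hs hψ hφ) (norm_nonneg _))
  have hlim : Filter.Tendsto (fun s : ℝ => Real.exp (-(n * s)) * ‖schwartzToL2 ψ‖ * ‖g‖)
      Filter.atTop (nhds 0) := by
    have h1 : Filter.Tendsto (fun s : ℝ => Real.exp (-(n * s))) Filter.atTop (nhds 0) :=
      Real.tendsto_exp_neg_atTop_nhds_zero.comp (Filter.tendsto_id.const_mul_atTop hn')
    simpa using (h1.mul_const ‖schwartzToL2 ψ‖).mul_const ‖g‖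
  have := ge_of_tendsto hlim (Filter.eventually_atTop.2 ⟨0, hbound⟩)
  exact norm_le_zero_iff.1 this

variable {g : SpaceTime n → ℂ}

theorem integrable_test_mul_wavePacket_mul (hg2 : MemLp g 2) {b : ℝ → ℝ} (hb : ContDiff ℝ ∞ b)
    (hb' : HasCompactSupport b) (ξ : Rn n) :
    Integrable (fun p : SpaceTime n => (b p.1 : ℂ) * (wavePacket ξ p * g p))
      ((volume : Measure ℝ).prod (volume : Measure (Rn n))) := by
  obtain ⟨ψ, hψ⟩ := exists_schwartz_wavePacket hb hb' ξ
  have := (ψ.memLp 2 volume).integrable_mul hg2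
  refine this.congr (Filter.Eventually.of_forall fun p => ?_)
  simp only [Pi.mul_apply, hψ]
  ring

theorem exists_test_eq_one (k : ℕ) : ∃ b : ℝ → ℝ, ContDiff ℝ ∞ b ∧ HasCompactSupport b ∧
    ∀ t : ℝ, |t| ≤ k → b t = 1 := by
  let χ : ContDiffBump (0 : ℝ) := ⟨k + 1, k + 2, by positivity, by linarith⟩
  refine ⟨χ, χ.contDiff, χ.hasCompactSupport, fun t ht => χ.one_of_mem_closedBall ?_⟩
  rw [Metric.mem_closedBall, Real.dist_eq, sub_zero]
  change |t| ≤ (k : ℝ) + 1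
  linarith

/-- Orthogonality to `b(t) v_ξ` for all test functions `b` localises to almost every time. -/
theorem ae_integral_wavePacket_mul_eq_zero (hg2 : MemLp g 2) (ξ : Rn n)
    (h0 : ∀ b : ℝ → ℝ, ContDiff ℝ ∞ b → HasCompactSupport b →
      ∫ p : SpaceTime n, (b p.1 : ℂ) * (wavePacket ξ p * g p) = 0) :
    ∀ᵐ t : ℝ, ∫ x, wavePacket ξ (t, x) * g (t, x) = 0 := by
  have hi : ∀ b : ℝ → ℝ, ContDiff ℝ ∞ b → HasCompactSupport b →
      Integrable fun t : ℝ => (b t : ℂ) * ∫ x, wavePacket ξ (t, x) * g (t, x) := by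
    intro b hb hb'
    simpa only [integral_const_mul] using
      (integrable_test_mul_wavePacket_mul hg2 hb hb' ξ).integral_prod_left
  refine ae_eq_zero_of_integral_contDiff_smul_eq_zero ?_ fun b hb hb' => ?_
  · rw [locallyIntegrable_iff]
    intro K hK
    obtain ⟨R, hR⟩ := hK.isBounded.subset_closedBall 0
    obtain ⟨k, hk⟩ := exists_nat_ge R
    obtain ⟨b, hb, hb', hb1⟩ := exists_test_eq_one k
    refine ((hi b hb hb').integrableOn (s := K)).congr_fun (fun t ht => ?_) hK.measurableSet
    have h1 := hR ht
    rw [Metric.mem_closedBall, Real.dist_eq, sub_zero] at h1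
    simp [hb1 t (h1.trans hk)]
  · have := h0 b hb hb'
    rw [Measure.volume_eq_prod,
      integral_prod _ (integrable_test_mul_wavePacket_mul hg2 hb hb' ξ)] at this
    simpa only [integral_const_mul, Complex.real_smul] using this

/-- Pairing a time slice with the wave packet samples a Fourier transform at `e^{-2t} ξ`. -/
theorem wavePacket_mul_eq_fourier (t : ℝ) (ξ : Rn n) :
    ∫ x, wavePacket ξ (t, x) * g (t, x) =
      (Real.exp (-(n * t) + Real.pi ^ 2 * Real.exp (-4 * t) * ‖ξ‖ ^ 2) : ℂ) *
        𝓕 (fun x : Rn n => (Real.exp (-(‖x‖ ^ 2 / 2)) : ℂ) * g (t, x)) (Real.exp (-2 * t) • ξ) := by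
  rw [Real.fourier_eq', ← integral_const_mul]
  refine integral_congr_ae (Filter.Eventually.of_forall fun x => ?_)
  simp only [wavePacket, inner_smul_right, smul_eq_mul]
  rw [← mul_assoc, ← mul_assoc]
  congr 1
  push_cast
  rw [← Complex.exp_add, ← Complex.exp_add]
  congr 1
  ring

theorem ae_integrable_gaussian_mul_slice (hg2 : MemLp g 2) :
    ∀ᵐ t : ℝ, Integrable fun x : Rn n => (Real.exp (-(‖x‖ ^ 2 / 2)) : ℂ) * g (t, x) := by
  choose b hb hb' hb1 using exists_test_eq_one
  have h := ae_all_iff.2 fun k =>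
    (integrable_test_mul_wavePacket_mul hg2 (hb k) (hb' k) (0 : Rn n)).prod_right_ae
  filter_upwards [h] with t ht
  obtain ⟨k, hk⟩ := exists_nat_ge |t|
  refine ((ht k).const_mul (Real.exp (n * t) : ℂ)).congr (Filter.Eventually.of_forall fun x => ?_)
  simp only [hb1 k t hk, wavePacket, Complex.ofReal_one, one_mul]
  rw [← mul_assoc]
  congr 1
  push_cast
  rw [← Complex.exp_add]
  congr 1
  simp
  ring

theorem ae_eq_zero_of_integral_wavePacket_eq_zero (hg : StronglyMeasurable g) (hg2 : MemLp g 2)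
    (h0 : ∀ (ξ : Rn n) (b : ℝ → ℝ), ContDiff ℝ ∞ b → HasCompactSupport b →
      ∫ p : SpaceTime n, (b p.1 : ℂ) * (wavePacket ξ p * g p) = 0) : g =ᵐ[volume] 0 := by
  -- a dense sequence of frequencies leaves only countably many exceptional sets of times
  have hall := ae_all_iff.2 fun k : ℕ => ae_integral_wavePacket_mul_eq_zero hg2
    (TopologicalSpace.denseSeq (Rn n) k) (h0 _)
  have hslice : ∀ᵐ t : ℝ, ∀ᵐ x : Rn n, g (t, x) = 0 := by
    filter_upwards [hall, ae_integrable_gaussian_mul_slice hg2] with t ht hint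
    have hcont : Continuous fun ξ : Rn n =>
        𝓕 (fun x : Rn n => (Real.exp (-(‖x‖ ^ 2 / 2)) : ℂ) * g (t, x))
          (Real.exp (-2 * t) • ξ) :=
      (VectorFourier.fourierIntegral_continuous (L := innerₗ (Rn n)) Real.continuous_fourierChar
        continuous_inner hint).comp (continuous_const_smul _)
    have hzero := hcont.ext_on (TopologicalSpace.denseRange_denseSeq (Rn n))
      (continuous_const (y := (0 : ℂ))) (by
        rintro _ ⟨k, rfl⟩
        have := ht k
        rw [wavePacket_mul_eq_fourier] at this
        refine (mul_eq_zero.1 this).resolve_left ?_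
        exact_mod_cast (Real.exp_pos _).ne')
    have hF : ∀ w, 𝓕 (fun x : Rn n => (Real.exp (-(‖x‖ ^ 2 / 2)) : ℂ) * g (t, x)) w = 0 := by
      intro w
      have := congrFun hzero (Real.exp (2 * t) • w)
      simpa [smul_smul, ← Real.exp_add] using this
    filter_upwards [ae_eq_zero_of_fourier_eq_zero hint hF] with x hx
    refine (mul_eq_zero.1 hx).resolve_left ?_
    exact_mod_cast (Real.exp_pos _).ne'
  rw [Measure.volume_eq_prod]
  exact (Measure.ae_prod_iff_ae_ae (p := fun p => g p = 0)
    (hg.measurable (measurableSet_singleton 0))).2 hslice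

/-- The range of `∂ₜ + H` on the domain where it is inverted by the integral operator is dense in
`L²`. -/
theorem denseRange_parabolicHermite (hn : 1 ≤ n) :
    DenseRange ((schwartzToL2 ∘ₗ parabolicHermite) ∘ₗ (invertibleDomain hn).subtype) := by
  rw [DenseRange, ← LinearMap.coe_range, Submodule.dense_iff_topologicalClosure_eq_top,
    Submodule.topologicalClosure_eq_top_iff, Submodule.eq_bot_iff]
  intro g hg
  rw [Submodule.mem_orthogonal] at hg
  have hg' : ∀ ψ ∈ invertibleDomain hn, inner ℂ (schwartzToL2 (parabolicHermite ψ)) g = 0 :=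
    fun ψ hψ => hg _ ⟨⟨ψ, hψ⟩, rfl⟩
  rw [Lp.eq_zero_iff_ae_eq_zero]
  refine ae_eq_zero_of_integral_wavePacket_eq_zero (Lp.stronglyMeasurable g) (Lp.memLp g)
    fun ξ b hb hb' => ?_
  obtain ⟨ψ, hψ⟩ := exists_schwartz_wavePacket hb hb' (-ξ)
  rw [← inner_wavePacket_eq_zero hn hg' hb hb' hψ, L2.inner_def]
  refine integral_congr_ae ?_
  filter_upwards [coeFn_schwartzToL2 ψ] with p hp
  rw [hp, hψ, RCLike.inner_apply, map_mul, conj_wavePacket, Complex.conj_ofReal]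
  ring

end Density

/-! ### The parabolic Hermite–Riesz transforms -/

section RieszTransforms

open scoped SchwartzMap

variable {n : ℕ}

theorem continuous_integral_mul {k : SpaceTime n → ℂ} (hk : MemLp k 2) :
    Continuous fun f : L2SpaceTime n => ∫ p, f p * k p := by
  have hk' : MemLp (fun p => (starRingEnd ℂ) (k p)) 2 := hk.star
  have h : (fun f : L2SpaceTime n => ∫ p, f p * k p) = fun f => inner ℂ hk'.toLp f := by
    funext f
    rw [L2.inner_def]
    refine integral_congr_ae ?_
    filter_upwards [hk'.coeFn_toLp] with p hp
    rw [hp, RCLike.inner_apply, Complex.conj_conj]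
  rw [h]
  exact continuous_const.inner continuous_id

/-- A differential operator `A`, with transpose `B`, that is bounded relative to `∂ₜ + H` gives a
bounded operator `A (∂ₜ + H)⁻¹`, the composition being taken in the weak sense. -/
theorem exists_weak_comp_inv (hn : 1 ≤ n) (A B : 𝓢(SpaceTime n, ℂ) →ₗ[ℂ] 𝓢(SpaceTime n, ℂ))
    (hAB : ∀ ψ φ : 𝓢(SpaceTime n, ℂ), ∫ p, ψ p * B φ p = ∫ p, A ψ p * φ p)
    (hA : ∃ C, ∀ ψ ∈ invertibleDomain hn,
      ‖schwartzToL2 (A ψ)‖ ≤ C * ‖schwartzToL2 (parabolicHermite ψ)‖) :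
    ∃ R : L2SpaceTime n →L[ℂ] L2SpaceTime n, ∀ (f : L2SpaceTime n) (φ : 𝓢(SpaceTime n, ℂ)),
      ∫ p, parabolicHermiteInv f p * B φ p = ∫ p, R f p * φ p := by
  have hdense := denseRange_parabolicHermite hn
  let e := (schwartzToL2 ∘ₗ parabolicHermite) ∘ₗ (invertibleDomain hn).subtype
  let F := (schwartzToL2 ∘ₗ A) ∘ₗ (invertibleDomain hn).subtype
  have hF : ∃ C, ∀ ψ, ‖F ψ‖ ≤ C * ‖e ψ‖ := hA.imp fun C hC ψ => hC ψ ψ.2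
  refine ⟨F.extendOfNorm e, fun f φ => ?_⟩
  have hT : ∫ p, parabolicHermiteInv f p * B φ p = ∫ p, parabolicHermiteInvL2 hn f p * B φ p := by
    refine integral_congr_ae ?_
    filter_upwards [coeFn_parabolicHermiteInvL2 hn f] with p hp
    rw [hp]
  rw [hT]
  refine hdense.induction_on (p := fun f : L2SpaceTime n =>
    ∫ p, parabolicHermiteInvL2 hn f p * B φ p = ∫ p, F.extendOfNorm e f p * φ p) f ?_ ?_
  · exact isClosed_eq
      ((continuous_integral_mul ((B φ).memLp 2 volume)).comp (parabolicHermiteInvL2 hn).continuous)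
      ((continuous_integral_mul (φ.memLp 2 volume)).comp (F.extendOfNorm e).continuous)
  · intro ψ
    have h1 : F.extendOfNorm e (e ψ) = schwartzToL2 (A ψ) :=
      LinearMap.extendOfNorm_eq hdense hF ψ
    have h2 : parabolicHermiteInvL2 hn (e ψ) = schwartzToL2 (ψ : 𝓢(SpaceTime n, ℂ)) :=
      mem_invertibleDomain.1 ψ.2
    change ∫ p, parabolicHermiteInvL2 hn (e ψ) p * B φ p = ∫ p, F.extendOfNorm e (e ψ) p * φ p
    rw [h1, h2]
    calc ∫ p, schwartzToL2 (ψ : 𝓢(SpaceTime n, ℂ)) p * B φ p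
        = ∫ p, (ψ : 𝓢(SpaceTime n, ℂ)) p * B φ p := by
          refine integral_congr_ae ?_
          filter_upwards [coeFn_schwartzToL2 (ψ : 𝓢(SpaceTime n, ℂ))] with p hp
          rw [hp]
      _ = ∫ p, A ψ p * φ p := hAB _ _
      _ = _ := by
          refine integral_congr_ae ?_
          filter_upwards [coeFn_schwartzToL2 (A ψ)] with p hp
          rw [hp]

theorem integral_mul_schwartzDeriv (v : SpaceTime n) (ψ φ : 𝓢(SpaceTime n, ℂ)) :
    ∫ p, ψ p * schwartzDeriv v φ p = -∫ p, schwartzDeriv v ψ p * φ p :=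
  SchwartzMap.integral_mul_lineDerivOp_right_eq_neg_left ψ φ v

theorem norm_le_of_mem_invertibleDomain {hn : 1 ≤ n} {ψ : 𝓢(SpaceTime n, ℂ)}
    (hψ : ψ ∈ invertibleDomain hn) :
    ‖schwartzToL2 ψ‖ ≤ ‖parabolicHermiteInvL2 hn‖ * ‖schwartzToL2 (parabolicHermite ψ)‖ := by
  rw [← mem_invertibleDomain.1 hψ]
  exact ContinuousLinearMap.le_opNorm _ _

theorem exists_isHermiteRieszTime (hn : 1 ≤ n) :
    ∃ R : L2SpaceTime n →L[ℂ] L2SpaceTime n, IsHermiteRieszTime R := by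
  obtain ⟨R, hR⟩ := exists_weak_comp_inv hn (schwartzDeriv (timeDir n)) (-schwartzDeriv (timeDir n))
    (fun ψ φ => by
      have := integral_mul_schwartzDeriv (timeDir n) ψ φ
      simp only [LinearMap.neg_apply, neg_apply, mul_neg, integral_neg, this, neg_neg])
    ⟨1, fun ψ _ => by rw [one_mul]; exact norm_timeDeriv_le ψ⟩
  refine ⟨R, fun f => ⟨(memLp_parabolicHermiteInv hn (Lp.stronglyMeasurable f)
    (Lp.memLp f)).locallyIntegrable (by norm_num),
    (Lp.memLp (R f)).locallyIntegrable (by norm_num), fun φ hφ hφ' => ?_⟩⟩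
  have h := hR f (hφ'.toSchwartzMap hφ)
  simp only [LinearMap.neg_apply, neg_apply, mul_neg, integral_neg, schwartzDeriv_apply] at h
  exact neg_eq_iff_eq_neg.1 h

theorem exists_isHermiteRieszSpace (hn : 1 ≤ n) (i j : Fin n) :
    ∃ R : L2SpaceTime n →L[ℂ] L2SpaceTime n, IsHermiteRieszSpace i j R := by
  let A := schwartzDeriv (spaceDir i) ∘ₗ schwartzDeriv (spaceDir j)
  obtain ⟨R, hR⟩ := exists_weak_comp_inv hn A A
    (fun ψ φ => by
      simp only [A, LinearMap.comp_apply]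
      rw [integral_mul_schwartzDeriv, integral_mul_schwartzDeriv, neg_neg, schwartzDeriv_comm])
    ⟨Real.sqrt (1 + 2 * n * ‖parabolicHermiteInvL2 hn‖ ^ 2), fun ψ hψ => by
      have h1 := norm_spaceDeriv_sq_le i j ψ
      have h2 := pow_le_pow_left₀ (norm_nonneg _) (norm_le_of_mem_invertibleDomain hψ) 2
      refine (pow_le_pow_iff_left₀ (norm_nonneg _) (by positivity) two_ne_zero).1 ?_
      rw [mul_pow, Real.sq_sqrt (by positivity)]
      rw [mul_pow] at h2
      have h3 := mul_le_mul_of_nonneg_left h2 (by positivity : (0 : ℝ) ≤ 2 * n)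
      refine h1.trans ?_
      linarith⟩
  refine ⟨R, fun f => ⟨(memLp_parabolicHermiteInv hn (Lp.stronglyMeasurable f)
    (Lp.memLp f)).locallyIntegrable (by norm_num),
    (Lp.memLp (R f)).locallyIntegrable (by norm_num), fun φ hφ hφ' => ?_⟩⟩
  exact hR f (hφ'.toSchwartzMap hφ)

theorem eq_of_integral_mul_test_eq {f g : L2SpaceTime n}
    (h : ∀ φ : SpaceTime n → ℂ, ContDiff ℝ ∞ φ → HasCompactSupport φ →
      ∫ p, f p * φ p = ∫ p, g p * φ p) : f = g := by
  refine Lp.ext (ae_eq_of_integral_contDiff_smul_eq ((Lp.memLp f).locallyIntegrable (by norm_num))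
    ((Lp.memLp g).locallyIntegrable (by norm_num)) fun φ hφ hφ' => ?_)
  have := h (fun p => (φ p : ℂ)) (Complex.ofRealCLM.contDiff.comp hφ)
    (hφ'.comp_left (g := Complex.ofReal) Complex.ofReal_zero)
  simpa only [Complex.real_smul, mul_comm] using this

end RieszTransforms

theorem theorem3p3 (n : ℕ) (hn : 1 ≤ n) :
    (∀ f : L2SpaceTime n,
      (∀ᵐ p : SpaceTime n, ParabolicHermiteInvConverges f p) ∧
        MemLp (parabolicHermiteInv f) 2 (volume : Measure (SpaceTime n))) ∧
    (∀ i j : Fin n, ∃! R : L2SpaceTime n →L[ℂ] L2SpaceTime n, IsHermiteRieszSpace i j R) ∧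
    (∃! R : L2SpaceTime n →L[ℂ] L2SpaceTime n, IsHermiteRieszTime R) := by
  refine ⟨fun f => ⟨?_, memLp_parabolicHermiteInv hn (Lp.stronglyMeasurable f) (Lp.memLp f)⟩,
    fun i j => ?_, ?_⟩
  · filter_upwards [ae_positiveInv_lt_top hn (Lp.stronglyMeasurable f) (Lp.memLp f)] with p hp
    exact convergesAt_of_positiveInv_lt_top (Lp.stronglyMeasurable f) hp
  · obtain ⟨R, hR⟩ := exists_isHermiteRieszSpace hn i j
    refine ⟨R, hR, fun S hS => ContinuousLinearMap.ext fun f => ?_⟩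
    refine eq_of_integral_mul_test_eq fun φ hφ hφ' => ?_
    rw [← (hS f).2.2 φ hφ hφ', ← (hR f).2.2 φ hφ hφ']
  · obtain ⟨R, hR⟩ := exists_isHermiteRieszTime hn
    refine ⟨R, hR, fun S hS => ContinuousLinearMap.ext fun f => ?_⟩
    refine eq_of_integral_mul_test_eq fun φ hφ hφ' => ?_
    rw [← neg_inj, ← (hS f).2.2 φ hφ hφ', ← (hR f).2.2 φ hφ hφ']
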